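/- Graphs are finite, simple and non-empty. A graph is Eulerian if all its vertex degrees are even (it need not be connected). An Eulerian orientation of $G$ is an orientation of its edges in which every vertex has equal in-degree and out-degree; $\varepsilon(G)$ is the number of Eulerian orientations and $v(G)$ the number of vertices of $G$. The $r$-ball $B_r(v)$ is the subgraph induced by the vertices at distance at most $r$ from $v$, rooted at $v$. A sequence $(G_n)$ of graphs is Benjamini–Schramm convergent if the degrees of all the $G_n$ have a common bound and, for every finite connected rooted graph $\alpha$ and every integer $r>0$, the probability that the $r$-ball at a uniform random vertex of $G_n$ is isomorphic to $\alpha$ (as a rooted graph) converges as $n\to\infty$. A graph parameter $f$ is estimable on a class $\mathcal C$ of graphs if it is bounded on $\mathcal C$ and for every $\epsilon>0$ there are positive integers $k,r$ and a real function $g$ of $k$-tuples of isomorphism classes of finite connected rooted graphs of radius at most $r$ such that, for every $G\in\mathcal C$ and independent uniform random vertices $v_1,\dots,v_k$ of $G$, $\mathbb P\big(|f(G)-g(B_r(v_1),\dots,B_r(v_k))|>\epsilon\big)\le\epsilon$. **Theorem.** Every Eulerian graph $G$ satisfies $\varepsilon(G)>0$, and the parameter $\frac{1}{v(G)}\ln\varepsilon(G)$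 is estimable for Eulerian graphs, in the following two senses. (i) If $(G_n)$ is a Benjamini–Schramm convergent sequence of Eulerian graphs, then $\lim_{n\to\infty}\frac{1}{v(G_n)}\ln\varepsilon(G_n)$ exists (as a real number). (ii) For every $\Delta$, the parameter $\frac{1}{v(G)}\ln\varepsilon(G)$ is estimable on the class of Eulerian graphs with all degrees at most $\Delta$. -/

import Mathlib

open Filter Topology

universe u

namespace EulerOr

/-- A finite simple graph with at least one vertex. -/
structure FinGraph : Type (u + 1) where
  /-- the vertices -/
  V : Type u
  [fintype : Fintype V]
  [nonempty : Nonempty V]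
  /-- the adjacency structure -/
  graph : SimpleGraph V

attribute [instance] FinGraph.fintype FinGraph.nonempty

/-- A finite connected rooted graph. -/
structure RootedGraph : Type (u + 1) where
  /-- the vertices -/
  V : Type u
  [finite : Finite V]
  /-- the adjacency structure -/
  graph : SimpleGraph V
  /-- the root -/
  root : V
  connected : graph.Connected

attribute [instance] RootedGraph.finite

/-- Isomorphism of rooted graphs: a graph isomorphism that takes the root to the root. -/
def RootedGraph.IsIso (A B : RootedGraph.{u}) : Prop :=
  ∃ e : A.graph ≃g B.graph, e A.root = B.root

/-- A rooted graph has radius at most `r` if all its vertices have distance at most `r` from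
the root. -/
def RootedGraph.RadiusLE (A : RootedGraph.{u}) (r : ℕ) : Prop :=
  ∀ w : A.V, A.graph.edist A.root w ≤ r

theorem RootedGraph.isIso_equivalence : Equivalence RootedGraph.IsIso.{u} where
  refl _ := ⟨SimpleGraph.Iso.refl, rfl⟩
  symm := by
    rintro _ _ ⟨e, he⟩
    exact ⟨e.symm, by rw [← he]; exact e.symm_apply_apply _⟩
  trans := by
    rintro _ _ _ ⟨e, he⟩ ⟨f, hf⟩
    exact ⟨e.trans f, by rw [← hf, ← he]; rfl⟩

/-- Rooted graphs of radius at most `r`, considered up to isomorphism of rooted graphs. -/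
instance RootedGraph.setoid (r : ℕ) : Setoid {A : RootedGraph.{u} // A.RadiusLE r} where
  r A B := A.1.IsIso B.1
  iseqv := ⟨fun _ => isIso_equivalence.refl _, fun h => isIso_equivalence.symm h,
    fun h h' => isIso_equivalence.trans h h'⟩

/-- The set of all possible `r`-neighbourhoods: isomorphism classes of finite connected rooted
graphs of radius at most `r`. -/
abbrev Neighbourhood (r : ℕ) : Type (u + 1) :=
  Quotient (RootedGraph.setoid.{u} r)

namespace FinGraph

/-- The number of vertices. -/
noncomputable def order (G : FinGraph.{u}) : ℕ := Nat.card G.V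

open Classical in
/-- The degree of a vertex. -/
noncomputable def deg (G : FinGraph.{u}) (v : G.V) : ℕ := G.graph.degree v

/-- Every vertex degree is even (connectedness is not required). -/
def IsEulerian (G : FinGraph.{u}) : Prop := ∀ v, Even (G.deg v)

/-- All degrees are at most `Δ`. -/
def MaxDegLE (G : FinGraph.{u}) (Δ : ℕ) : Prop := ∀ v, G.deg v ≤ Δ

/-- A digraph `D` is an orientation of `G`: its arcs lie along edges of `G`, and every edge of `G`
carries exactly one of its two possible arcs. -/
def IsOrientation (G : FinGraph.{u}) (D : Digraph G.V) : Prop :=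
  (∀ u v, D.Adj u v → G.graph.Adj u v) ∧
    ∀ u v, G.graph.Adj u v → Xor (D.Adj u v) (D.Adj v u)

/-- The out-degree equals the in-degree at every vertex. -/
def IsBalanced {V : Type u} (D : Digraph V) : Prop :=
  ∀ v, {w | D.Adj v w}.ncard = {w | D.Adj w v}.ncard

/-- The number of Eulerian (balanced) orientations. -/
noncomputable def numEulerianOrientations (G : FinGraph.{u}) : ℕ :=
  {D : Digraph G.V | G.IsOrientation D ∧ IsBalanced D}.ncard

/-- The parameter `(1 / v(G)) * ln ε(G)`. -/
noncomputable def entropy (G : FinGraph.{u}) : ℝ :=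
  1 / (G.order : ℝ) * Real.log (G.numEulerianOrientations : ℝ)

/-- The vertices at distance at most `r` from `v`. -/
def ballSet (G : FinGraph.{u}) (v : G.V) (r : ℕ) : Set G.V :=
  {w | G.graph.edist v w ≤ r}

theorem self_mem_ballSet (G : FinGraph.{u}) (v : G.V) (r : ℕ) : v ∈ G.ballSet v r := by
  simp [ballSet]

/-- Every vertex of a ball is joined to the centre by a path of length at most `r` inside it. -/
theorem exists_walk_ball (G : FinGraph.{u}) (v : G.V) (r : ℕ) (w : G.ballSet v r) :
    ∃ p : (G.graph.induce (G.ballSet v r)).Walk ⟨v, G.self_mem_ballSet v r⟩ w, p.length ≤ r := by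
  have hw : G.graph.edist v w ≤ r := w.2
  obtain ⟨p, hp⟩ := SimpleGraph.exists_walk_of_edist_ne_top
    (ne_top_of_le_ne_top (ENat.natCast_ne_top r) hw)
  have hp' : p.length ≤ r := by
    rw [← hp] at hw
    exact_mod_cast hw
  have hs : ∀ x ∈ p.support, x ∈ G.ballSet v r := by
    classical
    intro x hx
    have h1 : G.graph.edist v x ≤ ((p.takeUntil x hx).length : ℕ∞) :=
      SimpleGraph.Walk.edist_le _
    have h2 : (p.takeUntil x hx).length ≤ r := (p.length_takeUntil_le_length hx).trans hp'
    exact h1.trans (by exact_mod_cast h2)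
  refine ⟨p.induce _ hs, ?_⟩
  rw [← SimpleGraph.Walk.length_map (SimpleGraph.Embedding.induce _).toHom,
    SimpleGraph.Walk.map_induce]
  exact hp'

/-- The `r`-ball centred at `v`: the subgraph induced on the vertices at distance at most `r`
from `v`, rooted at `v`. -/
def ball (G : FinGraph.{u}) (v : G.V) (r : ℕ) : RootedGraph.{u} where
  V := G.ballSet v r
  graph := G.graph.induce (G.ballSet v r)
  root := ⟨v, G.self_mem_ballSet v r⟩
  connected := by
    have : Nonempty (G.ballSet v r) := ⟨⟨v, G.self_mem_ballSet v r⟩⟩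
    refine ⟨fun a b => ?_⟩
    obtain ⟨p, -⟩ := G.exists_walk_ball v r a
    obtain ⟨q, -⟩ := G.exists_walk_ball v r b
    exact ⟨p.reverse.append q⟩

theorem ball_radiusLE (G : FinGraph.{u}) (v : G.V) (r : ℕ) : (G.ball v r).RadiusLE r := by
  intro w
  obtain ⟨p, hp⟩ := G.exists_walk_ball v r w
  exact (SimpleGraph.Walk.edist_le p).trans (by exact_mod_cast hp)

/-- The isomorphism class of the `r`-ball centred at `v`. -/
def neighbourhood (G : FinGraph.{u}) (r : ℕ) (v : G.V) : Neighbourhood.{u} r :=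
  Quotient.mk _ ⟨G.ball v r, G.ball_radiusLE v r⟩

/-- The probability that the `r`-ball centred at a uniform random vertex of `G` is isomorphic
to `α`. -/
noncomputable def ballProb (G : FinGraph.{u}) (α : RootedGraph.{u}) (r : ℕ) : ℝ :=
  ({v : G.V | (G.ball v r).IsIso α}.ncard : ℝ) / (G.order : ℝ)

end FinGraph

/-- A graph sequence is bounded-degree if a single number bounds all degrees of all its members. -/
def BoundedDegree (G : ℕ → FinGraph.{u}) : Prop := ∃ Δ : ℕ, ∀ n, (G n).MaxDegLE Δ

/-- Benjamini–Schramm convergence: the sequence is bounded-degree, and all ball probabilities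
converge. -/
def BSConvergent (G : ℕ → FinGraph.{u}) : Prop :=
  BoundedDegree G ∧ ∀ (α : RootedGraph.{u}) (r : ℕ), 0 < r →
    ∃ p : ℝ, Tendsto (fun n => (G n).ballProb α r) atTop (𝓝 p)

/-- A graph parameter `f` is estimable on a class `C` of graphs: it is bounded on `C`, and for every
`ε > 0` there are positive integers `k`, `r` and an estimator `g`, a function of `k` many
`r`-neighbourhoods, such that for every `G` in `C` and independent uniform random vertices
`x 0, …, x (k - 1)` of `G`, the probability that `f G` differs by more than `ε` from the value of
`g` at the `r`-neighbourhoods of these vertices is at most `ε`. The probability is written as the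
proportion among all `k`-tuples of vertices. -/
def IsEstimableOn (C : Set FinGraph.{u}) (f : FinGraph.{u} → ℝ) : Prop :=
  (∃ M : ℝ, ∀ G ∈ C, |f G| ≤ M) ∧
    ∀ ε : ℝ, 0 < ε → ∃ k r : ℕ, 0 < k ∧ 0 < r ∧ ∃ g : (Fin k → Neighbourhood.{u} r) → ℝ,
      ∀ G ∈ C,
        ({x : Fin k → G.V | ε < |f G - g (fun i => G.neighbourhood r (x i))|}.ncard : ℝ) /
          (Nat.card (Fin k → G.V) : ℝ) ≤ ε

end EulerOr

namespace EulerOr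

/-! ### Zero-free regions: Asano contraction and the Gauss–Lucas theorem -/

section Analysis

open Polynomial

/-! Let every vertex choose half of its neighbours as out-neighbours, independently, and record a
choice by signs on the darts. An edge is consistently oriented exactly when its two signs have
product -1, so the product of 1 - (sign)(sign) over all edges is 2^e for an Eulerian orientation and
0 otherwise. Expanding over edge sets gives 2^e ε(G) = ∏ C(d, d/2) · F(1), where F = `genPoly G
univ` and the coefficient of an edge set is, up to sign, a product over vertices of normalised
middle Krawtchouk values (`two_pow_mul_numEulerianOrientations`). The binomials and 2^e are products
of functions of degrees, so only log F(1) needs work.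

Three facts control log F(1). First, F has no zero in the open unit disc (`aeval_genPoly_ne_zero`):
the edge factors are Asano contractions of quadratics whose sum over choices splits into vertex
factors, and these are nonzero by Gauss–Lucas. Hence log F(x) is well approximated by its Taylor
polynomial for 0 ≤ x < 1. Second, when all degrees are even the coefficients of F are nonnegative
(`edgeWeight_nonneg`), so x^e F(1) ≤ F(x) ≤ F(1), and replacing 1 by x < 1 costs at most -e log x.
This gets around the boundary of the disc, where zeros are not excluded.

Third, the Taylor coefficients of log F are local. As functions of the vertex set to which F is
restricted, they are additive over separated sets and polynomials of bounded degree in the vertex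
indicators, so their Möbius transforms live on small sets of bounded diameter
(`cumulant_eq_zero_of_far`). Sharing each such term among the vertices of its set writes the
coefficient as a sum of functions of balls.

Thus the entropy is uniformly close to the average of a ball statistic
(`exists_local_approximation`). With bounded degree only finitely many balls occur, so such averages
converge along Benjamini–Schramm convergent sequences, and Chebyshev's inequality shows that
sampling estimates them. -/

theorem ne_zero_of_forall_quadratic_ne_zero {a b d z : ℂ}
    (h : ∀ t : ℂ, ‖t‖ < 1 → a + b * t + d * t ^ 2 ≠ 0) (hz : ‖z‖ < 1) : a + d * z ≠ 0 := by
  intro h0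
  by_cases hd : d = 0
  · exact h 0 (by simp) (by simpa [hd] using h0)
  obtain ⟨s, hs⟩ := IsAlgClosed.exists_pow_nat_eq (b ^ 2 - 4 * d * a) (n := 2) two_pos
  set t₁ := (-b + s) / (2 * d) with ht₁
  set t₂ := (-b - s) / (2 * d) with ht₂
  have e₁ : a + b * t₁ + d * t₁ ^ 2 = 0 := by
    rw [ht₁]; field_simp; linear_combination hs
  have e₂ : a + b * t₂ + d * t₂ ^ 2 = 0 := by
    rw [ht₂]; field_simp; linear_combination hs
  -- If a + d z = 0, the two roots of the quadratic have product a / d = -z, so they cannot both lie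
  -- outside the open disc.
  have hp : t₁ * t₂ = -z := by
    rw [ht₁, ht₂]; field_simp; linear_combination -hs + 4 * d * h0
  have n₁ : 1 ≤ ‖t₁‖ := not_lt.1 fun hlt => h t₁ hlt e₁
  have n₂ : 1 ≤ ‖t₂‖ := not_lt.1 fun hlt => h t₂ hlt e₂
  have : 1 ≤ ‖t₁ * t₂‖ := by
    rw [norm_mul]; exact one_le_mul_of_one_le_of_one_le n₁ n₂
  rw [hp, norm_neg] at this
  exact absurd this (not_le.2 hz)

/-- Asano contraction of a family of quadratic factors. -/
theorem asano_contraction {Ω ι : Type*} [DecidableEq ι] (s : Finset Ω) (ρ τ : ι → Ω → ℂ) {z : ℂ}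
    (hz : ‖z‖ < 1) (E : Finset ι) (W : Ω → ℂ)
    (h : ∀ t : ι → ℂ, (∀ e, ‖t e‖ < 1) →
      ∑ x ∈ s, W x * ∏ e ∈ E, (1 + ρ e x * t e + τ e x * t e ^ 2) ≠ 0) :
    ∑ x ∈ s, W x * ∏ e ∈ E, (1 + τ e x * z) ≠ 0 := by
  induction E using Finset.induction_on generalizing W with
  | empty => simpa using h (fun _ => 0) (by simp)
  | insert e E he ih =>
    -- The factor of `e` is contracted with all other variables frozen; afterwards it no longer
    -- contains a variable and is absorbed into the weight.
    have key := ih (fun x => W x * (1 + τ e x * z)) fun t ht => by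
      set U : Ω → ℂ := fun x => W x * ∏ e ∈ E, (1 + ρ e x * t e + τ e x * t e ^ 2) with hU
      have := ne_zero_of_forall_quadratic_ne_zero (a := ∑ x ∈ s, U x)
        (b := ∑ x ∈ s, U x * ρ e x) (d := ∑ x ∈ s, U x * τ e x) (z := z) (fun r hr => ?_) hz
      · convert this using 1
        rw [Finset.sum_mul, ← Finset.sum_add_distrib]
        refine Finset.sum_congr rfl fun x _ => ?_
        simp only [hU]; ring
      · have := h (Function.update t e r) fun e' => by
          by_cases h' : e' = e
          · subst h'; simpa using hr
          · simpa [h'] using ht e'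
        convert this using 1
        rw [Finset.sum_mul, Finset.sum_mul, ← Finset.sum_add_distrib, ← Finset.sum_add_distrib]
        refine Finset.sum_congr rfl fun x _ => ?_
        rw [Finset.prod_insert he]
        have hE : ∏ i ∈ E, (1 + ρ i x * Function.update t e r i +
            τ i x * Function.update t e r i ^ 2) =
            ∏ i ∈ E, (1 + ρ i x * t i + τ i x * t i ^ 2) :=
          Finset.prod_congr rfl fun i hi => by
            rw [Function.update_of_ne (by rintro rfl; exact he hi)]
        rw [hE, Function.update_self]
        simp only [hU]; ring
    convert key using 1
    refine Finset.sum_congr rfl fun x _ => ?_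
    rw [Finset.prod_insert he]; ring

/-- Gauss–Lucas, iterated: the open left half-plane is convex, so it keeps containing the roots
after each differentiation. -/
theorem iterate_derivative_roots_re_neg {P : ℂ[X]} (hP : P ≠ 0) (h : ∀ z, P.IsRoot z → z.re < 0)
    (m : ℕ) (hm : m ≤ P.natDegree) :
    derivative^[m] P ≠ 0 ∧ (derivative^[m] P).natDegree = P.natDegree - m ∧
      ∀ z, (derivative^[m] P).IsRoot z → z.re < 0 := by
  induction m with
  | zero => exact ⟨hP, rfl, h⟩
  | succ m ih =>
    obtain ⟨h0, hd, hr⟩ := ih (by omega)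
    rw [Function.iterate_succ_apply']
    set Q := derivative^[m] P
    have hQ : 0 < Q.natDegree := by omega
    have hQd : Q.derivative.natDegree = Q.natDegree - 1 := natDegree_derivative Q
    have hne : Q.derivative ≠ 0 := fun h' => by
      have := derivative_eq_zero.1 h'
      omega
    refine ⟨hne, by omega, fun z hz => ?_⟩
    have := rootSet_derivative_subset_convexHull_rootSet (natDegree_pos_iff_degree_pos.1 hQ)
      (show z ∈ Q.derivative.rootSet ℂ by
        rw [mem_rootSet]; exact ⟨hne, by simpa using hz⟩)
    have hconv : Convex ℝ {w : ℂ | w.re < 0} := convex_halfSpace_re_lt 0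
    refine (convexHull_min ?_ hconv) this
    intro w hw
    rw [mem_rootSet] at hw
    exact hr w (by simpa using hw.2)

/-- A vanishing coefficient would make 0 a root of the m-th derivative, but 0 is not in the open
left half-plane. -/
theorem coeff_ne_zero_of_roots_re_neg {P : ℂ[X]} (hP : P ≠ 0) (h : ∀ z, P.IsRoot z → z.re < 0)
    (m : ℕ) (hm : m ≤ P.natDegree) : P.coeff m ≠ 0 := by
  intro h0
  have := (iterate_derivative_roots_re_neg hP h m hm).2.2 0 (by
    rw [IsRoot, ← coeff_zero_eq_eval_zero, coeff_iterate_derivative]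
    simp [h0])
  simp at this

theorem coeff_prod_C_mul_X_add_C {ι R : Type*} [DecidableEq ι] [CommRing R] (N : Finset ι)
    (a b : ι → R) (m : ℕ) :
    (∏ w ∈ N, (C (a w) * X + C (b w))).coeff m =
      ∑ S ∈ N.powersetCard m, (∏ w ∈ S, a w) * ∏ w ∈ N \ S, b w := by
  rw [Finset.prod_add, finsetSum_coeff, Finset.powersetCard_eq_filter, Finset.sum_filter]
  refine Finset.sum_congr rfl fun S _ => ?_
  rw [Finset.prod_mul_distrib, Finset.prod_const, ← map_prod, ← map_prod, mul_right_comm, ← C_mul,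
    coeff_C_mul, coeff_X_pow, mul_ite, mul_one, mul_zero]
  simp only [eq_comm]

theorem one_add_ne_zero_of_norm_lt_one {t : ℂ} (h : ‖t‖ < 1) : 1 + t ≠ 0 := by
  intro h0
  rw [eq_neg_of_add_eq_zero_right h0] at h
  simp at h

/-- The sum is the coefficient of X^m in ∏ ((1 + t) X + (1 - t)). The Cayley transform t ↦ -(1 -
t)/(1 + t) maps the unit disc to the left half-plane, so all roots of this product lie there. -/
theorem sum_powersetCard_prod_ne_zero {ι : Type*} [DecidableEq ι] (N : Finset ι) (t : ι → ℂ)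
    (ht : ∀ w, ‖t w‖ < 1) {m : ℕ} (hm : m ≤ N.card) :
    ∑ S ∈ N.powersetCard m, ∏ w ∈ N, (1 + (if w ∈ S then 1 else -1) * t w) ≠ 0 := by
  have hC : ∀ w, 1 + t w ≠ 0 := fun w => one_add_ne_zero_of_norm_lt_one (ht w)
  set P : ℂ[X] := ∏ w ∈ N, (C (1 + t w) * X + C (1 - t w)) with hPdef
  have hP : P ≠ 0 := by
    refine Finset.prod_ne_zero_iff.2 fun w _ h => ?_
    have := congrArg (fun Q => Polynomial.coeff Q 1) h
    simp [coeff_one] at this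
    exact hC w this
  have hdeg : P.natDegree = N.card := by
    rw [hPdef, natDegree_prod]
    · rw [Finset.sum_congr rfl fun w _ => natDegree_linear (hC w)]
      simp
    · exact Finset.prod_ne_zero_iff.1 hP
  have hroots : ∀ z, P.IsRoot z → z.re < 0 := by
    intro z hz
    rw [IsRoot, hPdef, eval_prod, Finset.prod_eq_zero_iff] at hz
    obtain ⟨w, -, hw⟩ := hz
    simp only [eval_add, eval_mul, eval_C, eval_X] at hw
    by_contra hre
    push Not at hre
    have h1 : (1 + t w) * (z + 1) = 2 * t w := by linear_combination hw
    have h2 : (1 + t w) * (z - 1) = -2 := by linear_combination hw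
    have h3 : ‖1 + t w‖ * ‖z + 1‖ = 2 * ‖t w‖ := by rw [← norm_mul, h1]; simp
    have h4 : ‖1 + t w‖ * ‖z - 1‖ = 2 := by rw [← norm_mul, h2]; simp
    have h5 : ‖z - 1‖ ≤ ‖z + 1‖ := by
      rw [← sq_le_sq₀ (norm_nonneg _) (norm_nonneg _), ← Complex.normSq_eq_norm_sq,
        ← Complex.normSq_eq_norm_sq, Complex.normSq_apply, Complex.normSq_apply]
      simp
      nlinarith
    have := mul_le_mul_of_nonneg_left h5 (norm_nonneg (1 + t w))
    linarith [ht w]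
  have key := coeff_ne_zero_of_roots_re_neg hP hroots m (hdeg ▸ hm)
  rw [hPdef, coeff_prod_C_mul_X_add_C] at key
  convert key using 2 with S hS
  rw [Finset.mem_powersetCard] at hS
  rw [← Finset.prod_sdiff hS.1, mul_comm]
  congr 1
  · exact Finset.prod_congr rfl fun w hw => by simp [hw]
  · exact Finset.prod_congr rfl fun w hw => by
      rw [if_neg (Finset.mem_sdiff.1 hw).2]; ring

/-! ### Logarithmic coefficients and truncation of the logarithm -/

/-- The coefficients of the logarithmic derivative of a polynomial. -/
noncomputable def logCoeff (P : ℝ[X]) (k : ℕ) : ℝ :=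
  PowerSeries.coeff k (PowerSeries.derivative ℝ (P : PowerSeries ℝ) * (P : PowerSeries ℝ)⁻¹)

theorem constantCoeff_coe_ne_zero {P : ℝ[X]} (h : P.coeff 0 = 1) :
    PowerSeries.constantCoeff (P : PowerSeries ℝ) ≠ 0 := by
  rw [← PowerSeries.coeff_zero_eq_constantCoeff_apply, coeff_coe, h]
  exact one_ne_zero

theorem logCoeff_mul {P Q : ℝ[X]} (hP : P.coeff 0 = 1) (hQ : Q.coeff 0 = 1) (k : ℕ) :
    logCoeff (P * Q) k = logCoeff P k + logCoeff Q k := by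
  have h1 := PowerSeries.mul_inv_cancel _ (constantCoeff_coe_ne_zero hP)
  have h2 := PowerSeries.mul_inv_cancel _ (constantCoeff_coe_ne_zero hQ)
  rw [logCoeff, logCoeff, logCoeff, ← map_add]
  congr 1
  rw [coe_mul, PowerSeries.mul_inv_rev, Derivation.leibniz]
  simp only [smul_eq_mul]
  linear_combination (PowerSeries.derivative ℝ (Q : PowerSeries ℝ)) * (Q : PowerSeries ℝ)⁻¹ * h1 +
    (PowerSeries.derivative ℝ (P : PowerSeries ℝ)) * (P : PowerSeries ℝ)⁻¹ * h2

theorem logCoeff_one (k : ℕ) : logCoeff 1 k = 0 := by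
  simp [logCoeff]

/-- Compare coefficients in P' = (P'/P) · P. This expresses `logCoeff` polynomially in the
coefficients of P, which later bounds its degree as a set function. -/
theorem logCoeff_recursion {P : ℝ[X]} (hP : P.coeff 0 = 1) (k : ℕ) :
    logCoeff P k = (k + 1) * P.coeff (k + 1) -
      ∑ i ∈ Finset.range k, logCoeff P i * P.coeff (k - i) := by
  have h1 := PowerSeries.mul_inv_cancel _ (constantCoeff_coe_ne_zero hP)
  have h2 : (PowerSeries.derivative ℝ (P : PowerSeries ℝ) * (P : PowerSeries ℝ)⁻¹) * P =
      PowerSeries.derivative ℝ (P : PowerSeries ℝ) := by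
    linear_combination PowerSeries.derivative ℝ (P : PowerSeries ℝ) * h1
  have h3 := congrArg (PowerSeries.coeff k) h2
  rw [PowerSeries.coeff_mul, PowerSeries.coeff_derivative,
    Finset.Nat.sum_antidiagonal_eq_sum_range_succ_mk, Finset.sum_range_succ] at h3
  simp only [coeff_coe, Nat.sub_self, hP] at h3
  simp only [logCoeff]
  linear_combination h3

theorem eq_prod_one_sub_of_eval_zero {P : ℂ[X]} (hP : P.coeff 0 = 1) :
    P = (P.roots.map fun r => 1 - C r⁻¹ * X).prod := by
  have hP0 : P ≠ 0 := by rintro rfl; simp at hP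
  have h0 : (0 : ℂ) ∉ P.roots := by
    rw [mem_roots hP0, IsRoot, ← coeff_zero_eq_eval_zero, hP]; exact one_ne_zero
  have aux : ∀ s : Multiset ℂ, (0 : ℂ) ∉ s → (s.map fun r => X - C r).prod =
      C (s.map fun r => -r).prod * (s.map fun r => 1 - C r⁻¹ * X).prod := by
    intro s
    induction s using Multiset.induction_on with
    | empty => simp
    | cons a s ih =>
      intro h
      rw [Multiset.mem_cons, not_or] at h
      have ha : C a * C a⁻¹ = 1 := by rw [← C_mul, mul_inv_cancel₀ (Ne.symm h.1), C_1]
      simp only [Multiset.map_cons, Multiset.prod_cons, ih h.2, C_mul, C_neg]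
      linear_combination (-X * C (s.map fun r => -r).prod * (s.map fun r => 1 - C r⁻¹ * X).prod) * ha
  have h1 := (IsAlgClosed.splits P).eq_prod_roots
  rw [aux _ h0, ← mul_assoc, ← C_mul] at h1
  have h2 := congrArg (fun Q => Polynomial.eval 0 Q) h1
  simp only [eval_mul, eval_C, ← coeff_zero_eq_eval_zero, hP] at h2
  have h3 : ((P.roots.map fun r => 1 - C r⁻¹ * X).prod).coeff 0 = 1 := by
    rw [coeff_zero_eq_eval_zero, eval_multiset_prod]
    simp
  rw [h3, mul_one] at h2
  rw [← h2, C_1, one_mul] at h1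
  exact h1

theorem logDeriv_prod_one_sub (s : Multiset ℂ) :
    PowerSeries.derivative ℂ (((s.map fun a => 1 - C a * X).prod : ℂ[X]) : PowerSeries ℂ) =
      PowerSeries.mk (fun k => -(s.map fun a => a ^ (k + 1)).sum) *
        ((s.map fun a => 1 - C a * X).prod : ℂ[X]) := by
  induction s using Multiset.induction_on with
  | empty =>
    ext k
    simp
  | cons a s ih =>
    have h1 : PowerSeries.mk (fun k => -((a ::ₘ s).map fun a => a ^ (k + 1)).sum) =
        PowerSeries.mk (fun k => -(s.map fun a => a ^ (k + 1)).sum) +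
          PowerSeries.mk (fun k => -a ^ (k + 1)) := by
      ext k; simp [add_comm]
    have h2 : PowerSeries.mk (fun k => -a ^ (k + 1)) * ((1 - C a * X : ℂ[X]) : PowerSeries ℂ) =
        -PowerSeries.C a := by
      ext k
      rw [coe_sub, coe_mul, coe_one, coe_C, coe_X, mul_sub, mul_one,
        mul_left_comm, map_sub, PowerSeries.coeff_mk, PowerSeries.coeff_C_mul, map_neg,
        PowerSeries.coeff_C]
      cases k with
      | zero => simp
      | succ k => rw [PowerSeries.coeff_succ_mul_X, PowerSeries.coeff_mk]; simp [pow_succ]; ring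
    have h3 : PowerSeries.derivative ℂ ((1 - C a * X : ℂ[X]) : PowerSeries ℂ) =
        -PowerSeries.C a := by
      rw [PowerSeries.derivative_coe]; simp
    rw [Multiset.map_cons, Multiset.prod_cons, coe_mul, Derivation.leibniz, ih, h1, h3]
    simp only [smul_eq_mul]
    linear_combination -((s.map fun a => 1 - C a * X).prod : ℂ[X]) * h2

/-- Each factor 1 - aX contributes -∑ a^(k+1) X^k to the logarithmic derivative; `s` is the multiset
of inverse roots. -/
theorem logCoeff_eq_sum_roots {P : ℝ[X]} (hP : P.coeff 0 = 1) {s : Multiset ℂ}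
    (hs : P.map Complex.ofRealHom = (s.map fun a => 1 - C a * X).prod) (k : ℕ) :
    (logCoeff P k : ℂ) = -(s.map fun a => a ^ (k + 1)).sum := by
  have h1 := PowerSeries.mul_inv_cancel _ (constantCoeff_coe_ne_zero hP)
  have h2 : (PowerSeries.derivative ℝ (P : PowerSeries ℝ) * (P : PowerSeries ℝ)⁻¹) * P =
      PowerSeries.derivative ℝ (P : PowerSeries ℝ) := by
    linear_combination PowerSeries.derivative ℝ (P : PowerSeries ℝ) * h1
  have h3 := congrArg (PowerSeries.map Complex.ofRealHom) h2
  rw [map_mul, PowerSeries.derivative_coe, ← polynomial_map_coe, ← polynomial_map_coe,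
    ← derivative_map, ← PowerSeries.derivative_coe (R := ℂ), hs, logDeriv_prod_one_sub, ← hs] at h3
  have hne : ((P.map Complex.ofRealHom : ℂ[X]) : PowerSeries ℂ) ≠ 0 := by
    intro h
    have := congrArg (PowerSeries.coeff 0) h
    rw [coeff_coe, coeff_map, hP] at this
    simp at this
  have h4 := mul_right_cancel₀ hne h3
  have h5 := congrArg (PowerSeries.coeff k) h4
  rw [PowerSeries.coeff_mk, PowerSeries.coeff_map, ← PowerSeries.derivative_coe] at h5
  exact h5

theorem abs_log_norm_one_sub_add_le {w : ℂ} {x : ℝ} (hw : ‖w‖ ≤ x) (hx : x < 1) (K : ℕ) :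
    |Real.log ‖1 - w‖ + (∑ k ∈ Finset.range K, w ^ (k + 1) / (k + 1)).re| ≤
      x ^ (K + 1) / (1 - x) := by
  have hw1 : ‖w‖ < 1 := hw.trans_lt hx
  have h := Complex.norm_log_sub_logTaylor_le K (z := -w) (by rwa [norm_neg])
  have h1 : Complex.logTaylor (K + 1) (-w) = -∑ k ∈ Finset.range K, w ^ (k + 1) / (k + 1) := by
    rw [Complex.logTaylor, Finset.sum_range_succ', ← Finset.sum_neg_distrib]
    simp only [Nat.cast_zero, div_zero, add_zero]
    refine Finset.sum_congr rfl fun k _ => ?_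
    rw [neg_pow w (k + 1), ← mul_assoc, ← pow_add]
    have : (-1 : ℂ) ^ (k + 1 + 1 + (k + 1)) = -1 := by
      rw [show k + 1 + 1 + (k + 1) = 2 * (k + 1) + 1 by ring, pow_succ, pow_mul]; simp
    rw [this]; push_cast; ring
  rw [h1, norm_neg, sub_neg_eq_add, ← sub_eq_add_neg] at h
  have h2 := (Complex.abs_re_le_norm _).trans h
  rw [Complex.add_re, Complex.log_re] at h2
  refine h2.trans ?_
  have hx0 : 0 ≤ x := (norm_nonneg w).trans hw
  have h3 : ‖w‖ ^ (K + 1) * (1 - ‖w‖)⁻¹ / (K + 1) ≤ ‖w‖ ^ (K + 1) * (1 - ‖w‖)⁻¹ :=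
    div_le_self (mul_nonneg (by positivity) (inv_nonneg.2 (by linarith))) (by simp)
  refine h3.trans ?_
  rw [div_eq_mul_inv]
  have : 0 < 1 - x := by linarith
  gcongr

theorem abs_log_norm_prod_le {s : Multiset ℂ} (hs : ∀ a ∈ s, ‖a‖ ≤ 1) {x : ℝ} (hx0 : 0 ≤ x)
    (hx : x < 1) (K : ℕ) :
    (s.map fun a => 1 - a * (x : ℂ)).prod ≠ 0 ∧
    |Real.log ‖(s.map fun a => 1 - a * (x : ℂ)).prod‖ +
      (∑ k ∈ Finset.range K, (s.map fun a => a ^ (k + 1)).sum * (x : ℂ) ^ (k + 1) / (k + 1)).re| ≤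
      s.card * (x ^ (K + 1) / (1 - x)) := by
  induction s using Multiset.induction_on with
  | empty => simp
  | cons a s ih =>
    obtain ⟨ih0, ih1⟩ := ih fun b hb => hs b (Multiset.mem_cons_of_mem hb)
    have hax : ‖a * (x : ℂ)‖ ≤ x := by
      rw [norm_mul, Complex.norm_real, Real.norm_of_nonneg hx0]
      exact mul_le_of_le_one_left hx0 (hs a (Multiset.mem_cons_self a s))
    have ha0 : 1 - a * (x : ℂ) ≠ 0 := by
      intro h
      rw [← sub_eq_zero.1 h, norm_one] at hax
      linarith
    have h1 := abs_log_norm_one_sub_add_le hax hx K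
    refine ⟨by simpa using ⟨ha0, by simpa using ih0⟩, ?_⟩
    rw [Multiset.map_cons, Multiset.prod_cons, norm_mul,
      Real.log_mul (norm_ne_zero_iff.2 ha0) (norm_ne_zero_iff.2 ih0), Multiset.card_cons]
    have h2 : (∑ k ∈ Finset.range K,
        ((a ::ₘ s).map fun a => a ^ (k + 1)).sum * (x : ℂ) ^ (k + 1) / (k + 1)) =
        (∑ k ∈ Finset.range K, (a * (x : ℂ)) ^ (k + 1) / (k + 1)) +
        ∑ k ∈ Finset.range K, (s.map fun a => a ^ (k + 1)).sum * (x : ℂ) ^ (k + 1) / (k + 1) := by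
      rw [← Finset.sum_add_distrib]
      refine Finset.sum_congr rfl fun k _ => ?_
      rw [Multiset.map_cons, Multiset.sum_cons]; ring
    rw [h2, Complex.add_re, add_add_add_comm]
    refine (abs_add_le _ _).trans ((add_le_add h1 ih1).trans (le_of_eq ?_))
    push_cast; ring

/-- Truncation of the logarithm of a polynomial without zeros in the open unit disc. -/
theorem abs_log_eval_sub_sum_logCoeff_le {P : ℝ[X]} (hP : P.coeff 0 = 1)
    (hroots : ∀ z : ℂ, ‖z‖ < 1 → aeval z P ≠ 0) {x : ℝ} (hx0 : 0 ≤ x) (hx : x < 1) (K : ℕ) :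
    |Real.log (P.eval x) - ∑ k ∈ Finset.range K, logCoeff P k * x ^ (k + 1) / (k + 1)| ≤
      P.natDegree * (x ^ (K + 1) / (1 - x)) := by
  set Q := P.map Complex.ofRealHom with hQ
  have hQ0 : Q.coeff 0 = 1 := by rw [hQ, coeff_map, hP]; simp
  have hQne : Q ≠ 0 := by rintro h; rw [h] at hQ0; simp at hQ0
  obtain ⟨s, hs⟩ : ∃ s, s = Q.roots.map fun r => r⁻¹ := ⟨_, rfl⟩
  have hprod : Q = (s.map fun a => 1 - C a * X).prod := by
    rw [hs, Multiset.map_map]; exact eq_prod_one_sub_of_eval_zero hQ0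
  have hs1 : ∀ a ∈ s, ‖a‖ ≤ 1 := by
    intro a ha
    rw [hs] at ha
    obtain ⟨r, hr, rfl⟩ := Multiset.mem_map.1 ha
    -- Zero-freeness enters here: it puts the inverse roots in the closed unit disc, so each
    -- satisfies the Taylor bound at x.
    have hr' : 1 ≤ ‖r‖ := by
      by_contra hlt
      refine hroots r (not_le.1 hlt) ?_
      rw [mem_roots hQne, IsRoot, hQ, eval_map] at hr
      exact hr
    rw [norm_inv]
    exact inv_le_one_of_one_le₀ hr'
  have hcard : s.card ≤ P.natDegree := by
    rw [hs, Multiset.card_map]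
    exact (card_roots' Q).trans natDegree_map_le
  obtain ⟨-, h⟩ := abs_log_norm_prod_le hs1 hx0 hx K
  have hev : (s.map fun a => 1 - a * (x : ℂ)).prod = ((P.eval x : ℝ) : ℂ) := by
    have h1 : Q.eval (x : ℂ) = ((P.eval x : ℝ) : ℂ) := by
      rw [hQ, eval_map]; exact (hom_eval₂ P (RingHom.id ℝ) Complex.ofRealHom x).symm
    rw [← h1, hprod, eval_multiset_prod, Multiset.map_map]
    simp only [Function.comp_def, eval_sub, eval_one, eval_mul, eval_C, eval_X]
  have hre : (∑ k ∈ Finset.range K,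
      (s.map fun a => a ^ (k + 1)).sum * (x : ℂ) ^ (k + 1) / (k + 1)).re =
      -∑ k ∈ Finset.range K, logCoeff P k * x ^ (k + 1) / (k + 1) := by
    rw [← Complex.ofReal_re (-∑ k ∈ Finset.range K, logCoeff P k * x ^ (k + 1) / (k + 1))]
    congr 1
    push_cast
    rw [← Finset.sum_neg_distrib]
    refine Finset.sum_congr rfl fun k _ => ?_
    rw [logCoeff_eq_sum_roots hP hprod]; ring
  rw [hev, hre, Complex.norm_real, Real.norm_eq_abs, Real.log_abs, ← sub_eq_add_neg] at h
  refine h.trans ?_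
  have : 0 < 1 - x := by linarith
  gcongr

end Analysis

end EulerOr

namespace EulerOr

/-! ### Signs of middle Krawtchouk values -/

section Krawtchouk

open Polynomial

/-- The middle coefficient of `(1 - X) ^ k * (1 + X) ^ (d - k)`. -/
noncomputable def krawtchouk (d k : ℕ) : ℝ :=
  (((1 - X) ^ k * (1 + X) ^ (d - k) : ℝ[X])).coeff (d / 2)

/-- From (1 - X)² = (1 + X)² - 4X. The recursion stays on middle coefficients and moves the
exponents by two, so it proves the even and odd cases separately. -/
theorem coeff_shift_recursion (a b n : ℕ) :
    ((1 - X) ^ (a + 2) * (1 + X) ^ b : ℝ[X]).coeff (n + 1) =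
      ((1 - X) ^ a * (1 + X) ^ (b + 2) : ℝ[X]).coeff (n + 1) -
        4 * ((1 - X) ^ a * (1 + X) ^ b : ℝ[X]).coeff n := by
  have h : ((1 - X) ^ (a + 2) * (1 + X) ^ b : ℝ[X]) =
      (1 - X) ^ a * (1 + X) ^ (b + 2) - C 4 * (X * ((1 - X) ^ a * (1 + X) ^ b)) := by
    rw [show (C 4 : ℝ[X]) = 4 from rfl]; ring
  rw [h, coeff_sub, coeff_C_mul, coeff_X_mul]

open Nat in
theorem coeff_even_even (j l : ℕ) :
    ((1 - X) ^ (2 * j) * (1 + X) ^ (2 * l) : ℝ[X]).coeff (j + l) =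
      (-1) ^ j * (((2 * j)! * (2 * l)! : ℕ) : ℝ) / ((j ! * l ! * (j + l)! : ℕ) : ℝ) := by
  induction j generalizing l with
  | zero =>
    have h := Nat.choose_mul_factorial_mul_factorial (show l ≤ 2 * l by omega)
    rw [show 2 * l - l = l by omega] at h
    have h' : ((2 * l).choose l : ℝ) * l ! * l ! = (2 * l)! := by exact_mod_cast h
    have := Nat.cast_ne_zero (R := ℝ).2 (Nat.factorial_ne_zero l)
    simp only [mul_zero, pow_zero, one_mul, zero_add, coeff_one_add_X_pow]
    push_cast
    rw [← h']
    field_simp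
  | succ j ih =>
    have h1 := ih (l + 1)
    have h2 := ih l
    rw [show 2 * (j + 1) = 2 * j + 2 by ring, show j + 1 + l = j + l + 1 by ring,
      coeff_shift_recursion, show 2 * l + 2 = 2 * (l + 1) by ring,
      show j + l + 1 = j + (l + 1) by ring, h1, h2, show 2 * (l + 1) = 2 * l + 1 + 1 by ring,
      show 2 * j + 2 = 2 * j + 1 + 1 by ring, show j + (l + 1) = j + l + 1 by ring]
    simp only [Nat.factorial_succ]
    have := Nat.cast_ne_zero (R := ℝ).2 (Nat.factorial_ne_zero l)
    have := Nat.cast_ne_zero (R := ℝ).2 (Nat.factorial_ne_zero j)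
    have := Nat.cast_ne_zero (R := ℝ).2 (Nat.factorial_ne_zero (j + l))
    push_cast
    field_simp
    ring

theorem coeff_odd_odd (j l : ℕ) :
    ((1 - X) ^ (2 * j + 1) * (1 + X) ^ (2 * l + 1) : ℝ[X]).coeff (j + l + 1) = 0 := by
  induction j generalizing l with
  | zero =>
    have h := Nat.choose_symm_of_eq_add (show 2 * l + 1 = (l + 1) + l by ring)
    simp only [mul_zero, zero_add, pow_one, sub_mul, one_mul, coeff_sub, coeff_X_mul,
      coeff_one_add_X_pow]
    rw [h, sub_self]
  | succ j ih =>
    rw [show 2 * (j + 1) + 1 = 2 * j + 1 + 2 by ring, show j + 1 + l + 1 = (j + l + 1) + 1 by ring,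
      coeff_shift_recursion, ih l, show 2 * l + 1 + 2 = 2 * (l + 1) + 1 by ring,
      show j + l + 1 + 1 = j + (l + 1) + 1 by ring, ih (l + 1)]
    ring

theorem krawtchouk_of_odd {d k : ℕ} (hd : Even d) (hk : Odd k) (hkd : k ≤ d) :
    krawtchouk d k = 0 := by
  obtain ⟨m, rfl⟩ := hd
  obtain ⟨j, rfl⟩ := hk
  obtain ⟨l, rfl⟩ : ∃ l, m = j + l + 1 := ⟨m - j - 1, by omega⟩
  rw [krawtchouk, ← coeff_odd_odd j l]
  congr 2
  · congr 2; omega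
  · omega

theorem neg_one_pow_mul_krawtchouk_nonneg {d j : ℕ} (hd : Even d) (hkd : 2 * j ≤ d) :
    0 ≤ (-1) ^ j * krawtchouk d (2 * j) := by
  obtain ⟨m, rfl⟩ := hd
  obtain ⟨l, rfl⟩ : ∃ l, m = j + l := ⟨m - j, by omega⟩
  have : krawtchouk (j + l + (j + l)) (2 * j) =
      ((1 - X) ^ (2 * j) * (1 + X) ^ (2 * l) : ℝ[X]).coeff (j + l) := by
    rw [krawtchouk]
    congr 2
    · congr 2; omega
    · omega
  rw [this, coeff_even_even, mul_div_assoc, ← mul_assoc, ← mul_pow]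
  simp only [mul_neg, mul_one, neg_neg, one_pow, one_mul]
  positivity

theorem krawtchouk_zero_right (d : ℕ) : krawtchouk d 0 = d.choose (d / 2) := by
  rw [krawtchouk, pow_zero, one_mul, Nat.sub_zero, coeff_one_add_X_pow]

/-- Both sides are the middle coefficient of a product of factors X - 1 for w in B and X + 1 for the
other w. The sign of w for S becomes that of the constant term picked outside S. -/
theorem sum_powersetCard_prod_sign {ι : Type*} [DecidableEq ι] (N B : Finset ι) (hB : B ⊆ N) :
    ∑ S ∈ N.powersetCard (N.card / 2), ∏ w ∈ B, (if w ∈ S then (1 : ℝ) else -1) =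
      (-1) ^ B.card * krawtchouk N.card B.card := by
  have h := coeff_prod_C_mul_X_add_C (R := ℝ) N (fun _ => 1) (fun w => if w ∈ B then -1 else 1)
    (N.card / 2)
  have h1 : ∏ w ∈ N, (C (1 : ℝ) * X + C (if w ∈ B then (-1 : ℝ) else 1)) =
      C ((-1) ^ B.card) * ((1 - X) ^ B.card * (1 + X) ^ (N.card - B.card)) := by
    have e1 : ∏ w ∈ N \ B, (C (1 : ℝ) * X + C (if w ∈ B then (-1 : ℝ) else 1)) =
        (1 + X) ^ (N.card - B.card) := by
      rw [← Finset.card_sdiff_of_subset hB, ← Finset.prod_const]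
      refine Finset.prod_congr rfl fun w hw => ?_
      rw [if_neg (Finset.mem_sdiff.1 hw).2, C_1]; ring
    have e2 : ∏ w ∈ B, (C (1 : ℝ) * X + C (if w ∈ B then (-1 : ℝ) else 1)) =
        (-1 * (1 - X)) ^ B.card := by
      rw [← Finset.prod_const]
      refine Finset.prod_congr rfl fun w hw => ?_
      rw [if_pos hw, C_neg, C_1]; ring
    rw [← Finset.prod_sdiff hB, e1, e2, mul_pow, C_pow, C_neg, C_1]
    ring
  rw [h1, coeff_C_mul] at h
  rw [krawtchouk, h]
  refine Finset.sum_congr rfl fun S hS => ?_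
  rw [Finset.prod_const_one, one_mul]
  have h2 : ∏ w ∈ N \ S, (if w ∈ B then (-1 : ℝ) else 1) = ∏ w ∈ B, if w ∈ S then 1 else -1 := by
    rw [Finset.prod_ite, Finset.prod_ite]
    simp only [Finset.prod_const, one_pow, mul_one, one_mul]
    congr 2
    ext w
    simp only [Finset.mem_filter, Finset.mem_sdiff]
    exact ⟨fun h => ⟨h.2, h.1.2⟩, fun h => ⟨⟨hB h.1, h.2⟩, h.1⟩⟩
  rw [h2]

/-- The normalised middle Krawtchouk coefficient. -/
noncomputable def vertexWeight (d k : ℕ) : ℝ :=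
  krawtchouk d k / d.choose (d / 2)

theorem choose_half_pos (d : ℕ) : 0 < d.choose (d / 2) := Nat.choose_pos (Nat.div_le_self d 2)

theorem vertexWeight_zero_right (d : ℕ) : vertexWeight d 0 = 1 := by
  rw [vertexWeight, krawtchouk_zero_right]
  exact div_self (Nat.cast_ne_zero.2 (choose_half_pos d).ne')

end Krawtchouk

end EulerOr

namespace EulerOr

/-! ### The generating polynomial: expansion, zeros and positivity -/

section EdgeSets

open Polynomial Classical

variable {V : Type*} [Fintype V]

/-- The number of edges of `A` at `v`. -/
noncomputable def incCount (A : Finset (Sym2 V)) (v : V) : ℕ := (A.filter fun e => v ∈ e).card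

/-- The product of `f` over the two orientations of an edge. -/
def dartProd {R : Type*} [CommMonoid R] (f : V → V → R) : Sym2 V → R :=
  Sym2.lift ⟨fun a b => f a b * f b a, fun _ _ => mul_comm _ _⟩

/-- A non-loop edge comes from exactly two ordered pairs. This turns products over edges into
products over vertices, so that sums over independent vertex choices factorise. -/
theorem prod_dartProd {R : Type*} [CommMonoid R] (f : V → V → R) (A : Finset (Sym2 V))
    (hA : ∀ e ∈ A, ¬ e.IsDiag) :
    ∏ e ∈ A, dartProd f e = ∏ v : V, ∏ w : V with s(v, w) ∈ A, f v w := by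
  have h1 : ∏ v : V, ∏ w : V with s(v, w) ∈ A, f v w =
      ∏ p : V × V with s(p.1, p.2) ∈ A, f p.1 p.2 := by
    rw [Finset.prod_filter, Fintype.prod_prod_type]
    exact Finset.prod_congr rfl fun v _ => by rw [Finset.prod_filter]
  rw [h1, ← Finset.prod_fiberwise_of_maps_to (t := A) (g := fun p : V × V => s(p.1, p.2))
    (fun p hp => (Finset.mem_filter.1 hp).2)]
  refine Finset.prod_congr rfl fun e he => ?_
  induction e using Sym2.ind with
  | _ a b =>
    have hab : a ≠ b := fun h => hA _ he (by simpa using h)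
    have h2 : (Finset.univ.filter fun p : V × V => s(p.1, p.2) ∈ A).filter
        (fun p => s(p.1, p.2) = s(a, b)) = {(a, b), (b, a)} := by
      ext ⟨x, y⟩
      simp only [Finset.mem_filter, Finset.mem_univ, true_and, Finset.mem_insert,
        Finset.mem_singleton, Prod.mk.injEq, Sym2.eq_iff]
      constructor
      · exact fun h => h.2
      · rintro (⟨rfl, rfl⟩ | ⟨rfl, rfl⟩)
        · exact ⟨he, Or.inl ⟨rfl, rfl⟩⟩
        · exact ⟨by rwa [Sym2.eq_swap], Or.inr ⟨rfl, rfl⟩⟩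
    rw [h2, Finset.prod_pair (by simp [hab])]
    rfl

theorem card_filter_mk_mem (A : Finset (Sym2 V)) (v : V) :
    (Finset.univ.filter fun w => s(v, w) ∈ A).card = incCount A v := by
  refine Finset.card_bij (fun w _ => s(v, w)) ?_ ?_ ?_
  · intro w hw
    simpa using hw
  · exact fun a _ b _ h => Sym2.congr_right.1 h
  · intro e he
    rw [Finset.mem_filter] at he
    obtain ⟨w, rfl⟩ := Sym2.mem_iff_exists.1 he.2
    exact ⟨w, by simpa using he.1, rfl⟩

/-- The handshake identity is `prod_dartProd` for a constant function, read additively. -/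
theorem sum_incCount (A : Finset (Sym2 V)) (hA : ∀ e ∈ A, ¬ e.IsDiag) :
    ∑ v, incCount A v = 2 * A.card := by
  have h := prod_dartProd (R := Multiplicative ℕ) (fun _ _ => Multiplicative.ofAdd 1) A hA
  have h1 : ∀ e : Sym2 V, dartProd (R := Multiplicative ℕ)
      (fun _ _ => Multiplicative.ofAdd 1) e = Multiplicative.ofAdd 2 :=
    fun e => Sym2.ind (fun _ _ => rfl) e
  have h2 := congrArg Multiplicative.toAdd h
  simp only [h1, Finset.prod_const, toAdd_pow, toAdd_prod, toAdd_ofAdd, smul_eq_mul,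
    card_filter_mk_mem, mul_one] at h2
  rw [← h2, mul_comm]

variable (G : SimpleGraph V)

/-- The weight of an edge set in the subgraph expansion of the number of Eulerian orientations. -/
noncomputable def edgeWeight (A : Finset (Sym2 V)) : ℝ :=
  (-1) ^ A.card * ∏ v, vertexWeight (G.degree v) (incCount A v)

/-- The edges of `G` inside the vertex set `S`. -/
noncomputable def edgesIn (S : Finset V) : Finset (Sym2 V) :=
  G.edgeFinset.filter (∀ v ∈ ·, v ∈ S)

/-- The generating polynomial of the edge weights inside the vertex set `S`. -/
noncomputable def genPoly (S : Finset V) : ℝ[X] :=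
  ∑ A ∈ (edgesIn G S).powerset, C (edgeWeight G A) * X ^ A.card

/-- The choices of half of the neighbours of every vertex. -/
noncomputable def halfChoices : Finset (V → Finset V) :=
  Fintype.piFinset fun v => (G.neighborFinset v).powersetCard (G.degree v / 2)

/-- The sign of `w` in the choice `s v` at `v`. -/
noncomputable def dartSign (R : Type*) [Ring R] (s : V → Finset V) (v w : V) : R :=
  if w ∈ s v then 1 else -1

variable {G}

theorem not_isDiag_of_subset_edgeFinset {A : Finset (Sym2 V)} (hA : A ⊆ G.edgeFinset) :
    ∀ e ∈ A, ¬ e.IsDiag := fun _ he =>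
  G.not_isDiag_of_mem_edgeSet (SimpleGraph.mem_edgeFinset.1 (hA he))

theorem edgesIn_univ : edgesIn G Finset.univ = G.edgeFinset := by
  simp [edgesIn]

theorem incCount_empty {V : Type*} (v : V) : incCount (∅ : Finset (Sym2 V)) v = 0 := rfl

theorem edgeWeight_empty : edgeWeight G ∅ = 1 := by
  simp [edgeWeight, incCount_empty, vertexWeight_zero_right]

theorem coeff_genPoly (S : Finset V) (j : ℕ) :
    (genPoly G S).coeff j = ∑ A ∈ (edgesIn G S).powersetCard j, edgeWeight G A := by
  rw [genPoly, finsetSum_coeff, Finset.powersetCard_eq_filter, Finset.sum_filter]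
  refine Finset.sum_congr rfl fun A _ => ?_
  rw [coeff_C_mul, coeff_X_pow, mul_ite, mul_one, mul_zero]
  simp only [eq_comm]

theorem coeff_zero_genPoly (S : Finset V) : (genPoly G S).coeff 0 = 1 := by
  simp [coeff_genPoly, edgeWeight_empty]

theorem natDegree_genPoly_le (S : Finset V) : (genPoly G S).natDegree ≤ G.edgeFinset.card := by
  refine natDegree_sum_le_of_forall_le _ _ fun A hA => ?_
  refine (natDegree_C_mul_X_pow_le _ _).trans (Finset.card_le_card ?_)
  exact (Finset.mem_powerset.1 hA).trans (Finset.filter_subset _ _)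

theorem incCount_le_degree {A : Finset (Sym2 V)} (hA : A ⊆ G.edgeFinset) (v : V) :
    incCount A v ≤ G.degree v := by
  rw [← card_filter_mk_mem, ← G.card_neighborFinset_eq_degree]
  refine Finset.card_le_card fun w hw => ?_
  have := hA (Finset.mem_filter.1 hw).2
  simpa using this

/-- If A has odd degree somewhere, that Krawtchouk value vanishes. Otherwise |A| is the sum of the
half-degrees of A, so (-1)^|A| distributes over the vertices and cancels the sign of each Krawtchouk
value. -/
theorem edgeWeight_nonneg (hG : ∀ v, Even (G.degree v)) {A : Finset (Sym2 V)}
    (hA : A ⊆ G.edgeFinset) : 0 ≤ edgeWeight G A := by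
  have hle := incCount_le_degree hA
  by_cases hodd : ∃ v, Odd (incCount A v)
  · obtain ⟨v, hv⟩ := hodd
    refine le_of_eq ?_
    rw [edgeWeight, Finset.prod_eq_zero (Finset.mem_univ v), mul_zero]
    rw [vertexWeight, krawtchouk_of_odd (hG v) hv (hle v), zero_div]
  · push Not at hodd
    have heven : ∀ v, incCount A v = 2 * (incCount A v / 2) := fun v => by
      obtain ⟨c, hc⟩ := Nat.not_odd_iff_even.1 (hodd v)
      omega
    have hcard : A.card = ∑ v, incCount A v / 2 := by
      have h1 := sum_incCount A (not_isDiag_of_subset_edgeFinset hA)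
      rw [Finset.sum_congr rfl fun v _ => heven v, ← Finset.mul_sum] at h1
      omega
    rw [edgeWeight, hcard, ← Finset.prod_pow_eq_pow_sum, ← Finset.prod_mul_distrib]
    refine Finset.prod_nonneg fun v _ => ?_
    rw [vertexWeight, ← mul_div_assoc]
    refine div_nonneg ?_ (Nat.cast_nonneg _)
    have := neg_one_pow_mul_krawtchouk_nonneg (hG v) (j := incCount A v / 2)
      ((heven v) ▸ hle v)
    rwa [← heven v] at this

theorem card_halfChoices : (halfChoices G).card = ∏ v, (G.degree v).choose (G.degree v / 2) := by
  rw [halfChoices, Fintype.card_piFinset]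
  exact Finset.prod_congr rfl fun v _ => by
    rw [Finset.card_powersetCard, G.card_neighborFinset_eq_degree]

/-- The vertex choices are independent, so the sum factorises. The signs from
`sum_powersetCard_prod_sign` cancel, because the degrees of A sum to 2|A|. -/
theorem sum_halfChoices_prod_dartProd {A : Finset (Sym2 V)} (hA : A ⊆ G.edgeFinset) :
    ∑ s ∈ halfChoices G, ∏ e ∈ A, dartProd (dartSign ℝ s) e =
      (-1) ^ A.card * ((halfChoices G).card * edgeWeight G A) := by
  have hdiag := not_isDiag_of_subset_edgeFinset hA
  have h1 : ∑ s ∈ halfChoices G, ∏ e ∈ A, dartProd (dartSign ℝ s) e =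
      ∏ v, ∑ S ∈ (G.neighborFinset v).powersetCard (G.degree v / 2),
        ∏ w : V with s(v, w) ∈ A, (if w ∈ S then (1 : ℝ) else -1) := by
    rw [Finset.prod_univ_sum]
    exact Finset.sum_congr rfl fun s _ => prod_dartProd _ A hdiag
  rw [h1, edgeWeight, card_halfChoices, Nat.cast_prod, mul_left_comm, ← mul_assoc _ _ (∏ _, _),
    ← pow_add, ← two_mul, ← sum_incCount A hdiag, ← Finset.prod_pow_eq_pow_sum,
    ← Finset.prod_mul_distrib, ← Finset.prod_mul_distrib]
  refine Finset.prod_congr rfl fun v _ => ?_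
  have h2 := sum_powersetCard_prod_sign (G.neighborFinset v)
    (Finset.univ.filter fun w => s(v, w) ∈ A) fun w hw => by
      simpa using hA (Finset.mem_filter.1 hw).2
  rw [G.card_neighborFinset_eq_degree, card_filter_mk_mem] at h2
  have h3 : ((G.degree v).choose (G.degree v / 2) : ℝ) ≠ 0 :=
    Nat.cast_ne_zero.2 (choose_half_pos _).ne'
  rw [h2, vertexWeight]
  field_simp

/-- The subgraph expansion of the partition function of half choices. -/
theorem sum_halfChoices_prod_one_sub {R : Type*} [CommRing R] [Algebra ℝ R] (z : R) :
    ∑ s ∈ halfChoices G, ∏ e ∈ G.edgeFinset, (1 + dartProd (dartSign R s) e * -z) =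
      (halfChoices G).card * aeval z (genPoly G Finset.univ) := by
  have hmap : ∀ (s : V → Finset V) e,
      dartProd (dartSign R s) e = algebraMap ℝ R (dartProd (dartSign ℝ s) e) := by
    intro s e
    induction e using Sym2.ind with
    | _ a b =>
      simp only [dartProd, Sym2.lift_mk, dartSign, map_mul, apply_ite (algebraMap ℝ R), map_one,
        map_neg]
  simp only [Finset.prod_one_add, Finset.prod_mul_distrib, Finset.prod_const]
  rw [Finset.sum_comm, genPoly, edgesIn_univ, map_sum, Finset.mul_sum]
  refine Finset.sum_congr rfl fun A hA => ?_
  rw [← Finset.sum_mul]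
  have h := congrArg (algebraMap ℝ R) (sum_halfChoices_prod_dartProd (Finset.mem_powerset.1 hA))
  simp only [map_sum, map_prod, ← hmap, map_mul, map_pow, map_neg, map_one, map_natCast] at h
  rw [h, map_mul, aeval_C, map_pow, aeval_X, neg_pow z]
  have : ((-1 : R) ^ A.card) * (-1) ^ A.card = 1 := by rw [← mul_pow]; simp
  linear_combination ((halfChoices G).card * algebraMap ℝ R (edgeWeight G A) * z ^ A.card) * this

theorem card_halfChoices_pos : 0 < (halfChoices G).card := by
  rw [card_halfChoices]
  exact Finset.prod_pos fun v _ => choose_half_pos _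

/-- The generating polynomial has no zeros in the open unit disc. -/
theorem aeval_genPoly_ne_zero {z : ℂ} (hz : ‖z‖ < 1) :
    aeval z (genPoly G Finset.univ) ≠ 0 := by
  have h := asano_contraction (halfChoices G)
    (ρ := fun e s => Sym2.lift ⟨fun a b => dartSign ℂ s a b + dartSign ℂ s b a,
      fun _ _ => add_comm _ _⟩ e)
    (τ := fun e s => dartProd (dartSign ℂ s) e) (z := -z) (by rwa [norm_neg]) G.edgeFinset
    -- Before contraction the quadratic of an edge ab is (1 + σ_ab t)(1 + σ_ba t), so the product
    -- over edges splits over the vertices and the sum over choices is a product of vertex sums.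
    (fun _ => 1) fun t ht => by
      have h1 : ∀ s : V → Finset V, ∏ e ∈ G.edgeFinset, (1 +
          Sym2.lift ⟨fun a b => dartSign ℂ s a b + dartSign ℂ s b a, fun _ _ => add_comm _ _⟩ e *
            t e + dartProd (dartSign ℂ s) e * t e ^ 2) =
          ∏ v, ∏ w ∈ G.neighborFinset v, (1 + (if w ∈ s v then 1 else -1) * t s(v, w)) := by
        intro s
        have h2 := prod_dartProd (fun v w => 1 + dartSign ℂ s v w * t s(v, w)) G.edgeFinset
          (not_isDiag_of_subset_edgeFinset subset_rfl)
        have h3 : ∀ v, (Finset.univ.filter fun w => s(v, w) ∈ G.edgeFinset) =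
            G.neighborFinset v := by intro v; ext w; simp
        simp only [h3] at h2
        rw [show (∏ v, ∏ w ∈ G.neighborFinset v, (1 + (if w ∈ s v then 1 else -1) * t s(v, w))) =
          ∏ v, ∏ w ∈ G.neighborFinset v, (1 + dartSign ℂ s v w * t s(v, w)) from rfl, ← h2]
        refine Finset.prod_congr rfl fun e _ => ?_
        induction e using Sym2.ind with
        | _ a b =>
          simp only [dartProd, Sym2.lift_mk]
          rw [Sym2.eq_swap (a := b) (b := a)]
          ring
      simp only [h1, one_mul]
      rw [halfChoices, ← Finset.prod_univ_sum (fun v => (G.neighborFinset v).powersetCard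
        (G.degree v / 2)) (fun v S => ∏ w ∈ G.neighborFinset v,
          (1 + (if w ∈ S then 1 else -1) * t s(v, w)))]
      refine Finset.prod_ne_zero_iff.2 fun v _ => ?_
      refine sum_powersetCard_prod_ne_zero _ _ (fun w => ht _) ?_
      rw [G.card_neighborFinset_eq_degree]
      exact Nat.div_le_self _ _
  simp only [one_mul, sum_halfChoices_prod_one_sub] at h
  exact right_ne_zero_of_mul h

/-- All coefficients are nonnegative, the constant term is 1 and no exponent exceeds the number of
edges. -/
theorem eval_genPoly_le (hG : ∀ v, Even (G.degree v)) {x : ℝ} (hx0 : 0 ≤ x) (hx1 : x ≤ 1) :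
    (genPoly G Finset.univ).eval x ≤ (genPoly G Finset.univ).eval 1 ∧
    x ^ G.edgeFinset.card * (genPoly G Finset.univ).eval 1 ≤ (genPoly G Finset.univ).eval x ∧
    1 ≤ (genPoly G Finset.univ).eval x := by
  have hev : ∀ y : ℝ, (genPoly G Finset.univ).eval y =
      ∑ A ∈ G.edgeFinset.powerset, edgeWeight G A * y ^ A.card := by
    intro y
    simp [genPoly, edgesIn_univ, eval_finsetSum]
  have hnn : ∀ A ∈ G.edgeFinset.powerset, 0 ≤ edgeWeight G A := fun A hA =>
    edgeWeight_nonneg hG (Finset.mem_powerset.1 hA)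
  simp only [hev]
  refine ⟨Finset.sum_le_sum fun A hA => ?_, ?_, ?_⟩
  · rw [one_pow]
    exact mul_le_mul_of_nonneg_left (pow_le_one₀ hx0 hx1) (hnn A hA)
  · rw [Finset.mul_sum]
    refine Finset.sum_le_sum fun A hA => ?_
    rw [one_pow, mul_one, mul_comm]
    exact mul_le_mul_of_nonneg_left (pow_le_pow_of_le_one hx0 hx1
      (Finset.card_le_card (Finset.mem_powerset.1 hA))) (hnn A hA)
  · have h := Finset.single_le_sum (f := fun A => edgeWeight G A * x ^ A.card)
      (fun A hA => mul_nonneg (hnn A hA) (pow_nonneg hx0 _)) (Finset.empty_mem_powerset G.edgeFinset)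
    simpa [edgeWeight_empty] using h

end EdgeSets

end EulerOr

namespace EulerOr

/-! ### Eulerian orientations as consistent half choices -/

section Orientations

open Polynomial Classical

variable (G : FinGraph.{u})

/-- An orientation corresponds to its out-neighbourhoods. Balance means that each contains half of
the neighbours, exactly since degrees are even, and sign product -1 on an edge means that just one
endpoint chose the other. -/
theorem FinGraph.numEulerianOrientations_eq_card (hG : G.IsEulerian) :
    G.numEulerianOrientations = ((halfChoices G.graph).filter fun s =>
      ∀ e ∈ G.graph.edgeFinset, dartProd (dartSign ℝ s) e = -1).card := by
  rw [FinGraph.numEulerianOrientations, ← Set.ncard_coe_finset]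
  have hsign : ∀ (s : G.V → Finset G.V) (a b : G.V),
      dartProd (dartSign ℝ s) s(a, b) = -1 ↔ Xor (b ∈ s a) (a ∈ s b) := by
    intro s a b
    simp only [dartProd, Sym2.lift_mk, dartSign, xor_def]
    by_cases h1 : b ∈ s a <;> by_cases h2 : a ∈ s b <;> simp [h1, h2] <;> norm_num
  have hdeg : ∀ v, G.graph.degree v = G.deg v := fun v => rfl
  refine Set.ncard_congr (fun D _ v => Finset.univ.filter fun w => D.Adj v w) ?_ ?_ ?_
  · rintro D ⟨⟨h1, h2⟩, h3⟩
    simp only [Finset.coe_filter, Set.mem_ofPred_eq, halfChoices, Fintype.mem_piFinset,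
      Finset.mem_powersetCard]
    refine ⟨fun v => ⟨fun w hw => ?_, ?_⟩, fun e he => ?_⟩
    · simpa using h1 v w (by simpa using hw)
    · have hb : (Finset.univ.filter fun w => D.Adj v w).card =
          (Finset.univ.filter fun w => D.Adj w v).card := by
        rw [← Set.ncard_coe_finset, ← Set.ncard_coe_finset]
        simpa using h3 v
      have hun : G.graph.neighborFinset v =
          (Finset.univ.filter fun w => D.Adj v w) ∪ Finset.univ.filter fun w => D.Adj w v := by
        ext w
        simp only [SimpleGraph.mem_neighborFinset, Finset.mem_union, Finset.mem_filter,
          Finset.mem_univ, true_and]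
        exact ⟨fun h => (h2 v w h).or, fun h => h.elim (h1 v w) fun h' => (h1 w v h').symm⟩
      have hdis : Disjoint (Finset.univ.filter fun w => D.Adj v w)
          (Finset.univ.filter fun w => D.Adj w v) := by
        rw [Finset.disjoint_filter]
        intro w _ ha hb'
        rcases h2 v w (h1 v w ha) with h | h
        · exact h.2 hb'
        · exact h.2 ha
      have hc := congrArg Finset.card hun
      rw [Finset.card_union_of_disjoint hdis, G.graph.card_neighborFinset_eq_degree, ← hb] at hc
      omega
    · induction e using Sym2.ind with
      | _ a b =>
        rw [hsign]
        simpa using h2 a b (by simpa using he)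
  · intro D D' _ _ h
    ext v w
    have := congrArg (fun s => w ∈ s v) h
    simpa using this
  · intro s hs
    simp only [Finset.coe_filter, Set.mem_ofPred_eq, halfChoices, Fintype.mem_piFinset,
      Finset.mem_powersetCard] at hs
    obtain ⟨h1, h2⟩ := hs
    have hadj : ∀ v w, w ∈ s v → G.graph.Adj v w := fun v w hw => by simpa using (h1 v).1 hw
    have hxor : ∀ v w, G.graph.Adj v w → Xor (w ∈ s v) (v ∈ s w) := fun v w hvw =>
      (hsign s v w).1 (h2 _ (by simpa using hvw))
    refine ⟨⟨fun v w => w ∈ s v⟩, ⟨⟨hadj, hxor⟩, fun v => ?_⟩, ?_⟩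
    · have e1 : {w | w ∈ s v} = ((s v : Finset G.V) : Set G.V) := rfl
      have e2 : {w | v ∈ s w} = ((G.graph.neighborFinset v \ s v : Finset G.V) : Set G.V) := by
        ext w
        simp only [Set.mem_ofPred_eq, Finset.coe_sdiff, Set.mem_sdiff, Finset.mem_coe,
          SimpleGraph.mem_neighborFinset]
        constructor
        · intro h
          have ha := (hadj w v h).symm
          refine ⟨ha, fun h' => ?_⟩
          rcases hxor v w ha with h'' | h''
          · exact h''.2 h
          · exact h''.2 h'
        · rintro ⟨ha, hn⟩
          exact (hxor v w ha).or.resolve_left hn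
      change {w | w ∈ s v}.ncard = {w | v ∈ s w}.ncard
      rw [e1, e2, Set.ncard_coe_finset, Set.ncard_coe_finset, Finset.card_sdiff_of_subset (h1 v).1,
        (h1 v).2, G.graph.card_neighborFinset_eq_degree]
      obtain ⟨c, hc⟩ := hG v
      rw [← hdeg] at hc
      omega
    · funext v
      ext w
      simp

/-- The number of Eulerian orientations in terms of the generating polynomial. -/
theorem FinGraph.two_pow_mul_numEulerianOrientations (hG : G.IsEulerian) :
    (2 : ℝ) ^ G.graph.edgeFinset.card * G.numEulerianOrientations =
      (halfChoices G.graph).card * (genPoly G.graph Finset.univ).eval 1 := by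
  have h := sum_halfChoices_prod_one_sub (G := G.graph) (1 : ℝ)
  rw [coe_aeval_eq_eval] at h
  rw [← h, G.numEulerianOrientations_eq_card hG, Finset.card_filter, Nat.cast_sum, Finset.mul_sum]
  refine Finset.sum_congr rfl fun s _ => ?_
  have hsign : ∀ e : Sym2 G.V, dartProd (dartSign ℝ s) e = 1 ∨ dartProd (dartSign ℝ s) e = -1 := by
    intro e
    induction e using Sym2.ind with
    | _ a b =>
      simp only [dartProd, Sym2.lift_mk, dartSign]
      by_cases h1 : b ∈ s a <;> by_cases h2 : a ∈ s b <;> simp [h1, h2]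
  split_ifs with hs
  · rw [Finset.prod_congr rfl fun e he => by rw [hs e he], Finset.prod_const]
    norm_num
  · push Not at hs
    obtain ⟨e, he, hne⟩ := hs
    -- An inconsistent edge has sign product 1 and contributes the factor 1 - 1 = 0.
    rw [Finset.prod_eq_zero he]
    · simp
    · rw [(hsign e).resolve_right hne]; norm_num

theorem FinGraph.numEulerianOrientations_pos (hG : G.IsEulerian) :
    0 < G.numEulerianOrientations := by
  have h := G.two_pow_mul_numEulerianOrientations hG
  have h1 := (eval_genPoly_le (G := G.graph) hG zero_le_one le_rfl).2.2
  have h2 : (0 : ℝ) < (halfChoices G.graph).card := Nat.cast_pos.2 card_halfChoices_pos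
  have h3 : 0 < (2 : ℝ) ^ G.graph.edgeFinset.card * G.numEulerianOrientations := by
    rw [h]; exact mul_pos h2 (by linarith)
  have h4 := pos_of_mul_pos_right h3 (by positivity)
  exact_mod_cast h4

theorem FinGraph.two_mul_card_edgeFinset :
    2 * G.graph.edgeFinset.card = ∑ v, G.deg v :=
  (G.graph.sum_degrees_eq_twice_card_edges).symm

theorem FinGraph.log_numEulerianOrientations (hG : G.IsEulerian) :
    Real.log G.numEulerianOrientations =
      ∑ v, (Real.log ((G.deg v).choose (G.deg v / 2)) - (G.deg v : ℝ) / 2 * Real.log 2) +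
        Real.log ((genPoly G.graph Finset.univ).eval 1) := by
  have h := congrArg Real.log (G.two_pow_mul_numEulerianOrientations hG)
  have h1 := (eval_genPoly_le (G := G.graph) hG zero_le_one le_rfl).2.2
  have h2 : ((halfChoices G.graph).card : ℝ) ≠ 0 := Nat.cast_ne_zero.2 card_halfChoices_pos.ne'
  have h3 : (G.numEulerianOrientations : ℝ) ≠ 0 :=
    Nat.cast_ne_zero.2 (G.numEulerianOrientations_pos hG).ne'
  rw [Real.log_mul (by positivity) h3, Real.log_mul h2 (by positivity), card_halfChoices,
    Nat.cast_prod, Real.log_prod (fun v _ => Nat.cast_ne_zero.2 (choose_half_pos _).ne'),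
    Real.log_pow] at h
  have h4 : (2 : ℝ) * G.graph.edgeFinset.card = ∑ v, (G.deg v : ℝ) := by
    exact_mod_cast G.two_mul_card_edgeFinset
  rw [Finset.sum_sub_distrib, ← Finset.sum_mul, ← Finset.sum_div, ← h4]
  simp only [FinGraph.deg]
  linear_combination h

end Orientations

end EulerOr

namespace EulerOr

/-! ### Möbius transforms of set functions -/

section Mobius

open Polynomial Classical

variable {V : Type*}

/-- The Möbius transform of a set function. -/
noncomputable def mobius (h : Finset V → ℝ) (S : Finset V) : ℝ :=
  ∑ T ∈ S.powerset, (-1) ^ (S.card + T.card) * h T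

/-- Pair each T avoiding v with T ∪ {v}: the terms cancel. -/
theorem sum_powerset_neg_one_pow_mul_eq_zero {S : Finset V} {v : V} (hv : v ∈ S) (g : Finset V → ℝ)
    (hg : ∀ T ⊆ S, g (insert v T) = g T) : ∑ T ∈ S.powerset, (-1) ^ T.card * g T = 0 := by
  rw [← Finset.insert_erase hv, Finset.sum_powerset_insert (Finset.notMem_erase v S),
    ← Finset.sum_add_distrib]
  refine Finset.sum_eq_zero fun T hT => ?_
  rw [Finset.mem_powerset] at hT
  have hvT : v ∉ T := fun h => Finset.notMem_erase v S (hT h)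
  rw [Finset.card_insert_of_notMem hvT, hg T (hT.trans (Finset.erase_subset v S)), pow_succ]
  ring

theorem mobius_eq_zero_of_insert {S : Finset V} {v : V} (hv : v ∈ S) (h : Finset V → ℝ)
    (hh : ∀ T ⊆ S, h (insert v T) = h T) : mobius h S = 0 := by
  have := sum_powerset_neg_one_pow_mul_eq_zero hv h hh
  simp only [mobius, pow_add, mul_assoc]
  rw [← Finset.mul_sum, this, mul_zero]

theorem sum_mobius (h : Finset V → ℝ) (U : Finset V) : ∑ S ∈ U.powerset, mobius h S = h U := by
  simp only [mobius]
  rw [Finset.sum_comm' (t' := U.powerset) (s' := fun T => U.powerset.filter (T ⊆ ·))]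
  · rw [Finset.sum_eq_single_of_mem U (Finset.mem_powerset_self U)]
    · have : U.powerset.filter (U ⊆ ·) = {U} := by
        ext S
        simp only [Finset.mem_filter, Finset.mem_powerset, Finset.mem_singleton]
        exact ⟨fun h => h.1.antisymm h.2, fun h => by rw [h]; exact ⟨subset_rfl, subset_rfl⟩⟩
      rw [this, Finset.sum_singleton, ← two_mul, pow_mul]
      simp
    · intro T hT hne
      rw [Finset.mem_powerset] at hT
      obtain ⟨v, hvU, hvT⟩ := Finset.exists_of_ssubset (hT.ssubset_of_ne hne)
      have := sum_powerset_neg_one_pow_mul_eq_zero hvU (fun S => if T ⊆ S then (1 : ℝ) else 0)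
        fun S _ => by
          have : T ⊆ insert v S ↔ T ⊆ S := Finset.subset_insert_iff_of_notMem hvT
          simp only [this]
      simp only [pow_add, mul_assoc]
      simp only [mul_ite, mul_one, mul_zero] at this
      rw [← Finset.sum_mul, Finset.sum_filter, this, zero_mul]
  · intro S T
    simp only [Finset.mem_powerset, Finset.mem_filter]
    exact ⟨fun h => ⟨⟨h.1, h.2⟩, h.2.trans h.1⟩, fun h => ⟨h.1.1, h.1.2⟩⟩

/-- Set functions that are linear combinations of indicators of containing a set of at most `m`
elements. -/
def degreeLE (V : Type*) (m : ℕ) : Submodule ℝ (Finset V → ℝ) :=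
  Submodule.span ℝ {f | ∃ A : Finset V, A.card ≤ m ∧ f = fun S => if A ⊆ S then 1 else 0}

theorem degreeLE_mono {m n : ℕ} (h : m ≤ n) : degreeLE V m ≤ degreeLE V n :=
  Submodule.span_mono fun _ ⟨A, hA, hf⟩ => ⟨A, hA.trans h, hf⟩

theorem mul_mem_degreeLE {m n : ℕ} {f g : Finset V → ℝ} (hf : f ∈ degreeLE V m)
    (hg : g ∈ degreeLE V n) : f * g ∈ degreeLE V (m + n) := by
  have h := Submodule.mul_mem_mul hf hg
  rw [degreeLE, degreeLE, Submodule.span_mul_span] at h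
  refine Submodule.span_mono ?_ h
  rintro _ ⟨_, ⟨A, hA, rfl⟩, _, ⟨B, hB, rfl⟩, rfl⟩
  refine ⟨A ∪ B, (Finset.card_union_le A B).trans (add_le_add hA hB), ?_⟩
  funext S
  simp only [Pi.mul_apply, Finset.union_subset_iff]
  by_cases h1 : A ⊆ S <;> by_cases h2 : B ⊆ S <;> simp [h1, h2]

/-- The indicator of containing A ignores any element of S outside A, and one exists when |S| > m ≥
|A|. -/
theorem mobius_eq_zero_of_mem_degreeLE {m : ℕ} {h : Finset V → ℝ} (hh : h ∈ degreeLE V m)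
    {S : Finset V} (hS : m < S.card) : mobius h S = 0 := by
  induction hh using Submodule.span_induction with
  | mem f hf =>
    obtain ⟨A, hA, rfl⟩ := hf
    obtain ⟨v, hvS, hvA⟩ := Finset.exists_mem_notMem_of_card_lt_card (hA.trans_lt hS)
    refine mobius_eq_zero_of_insert hvS _ fun T _ => ?_
    have : A ⊆ insert v T ↔ A ⊆ T := Finset.subset_insert_iff_of_notMem hvA
    simp only [this]
  | zero => simp [mobius]
  | add f g _ _ ihf ihg =>
    have : mobius (f + g) S = mobius f S + mobius g S := by
      simp only [mobius, Pi.add_apply, mul_add, Finset.sum_add_distrib]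
    rw [this, ihf, ihg, add_zero]
  | smul c f _ ih =>
    have : mobius (c • f) S = c * mobius f S := by
      simp only [mobius, Pi.smul_apply, smul_eq_mul, mul_left_comm _ c, ← Finset.mul_sum]
    rw [this, ih, mul_zero]

/-- Each of the two summands ignores the elements of the other nonempty part. -/
theorem mobius_eq_zero_of_additive {h : Finset V → ℝ} {S A B : Finset V} (hS : S = A ∪ B)
    (hd : Disjoint A B) (hA : A.Nonempty) (hB : B.Nonempty)
    (hadd : ∀ T ⊆ S, h T = h (T ∩ A) + h (T ∩ B)) : mobius h S = 0 := by
  obtain ⟨a, ha⟩ := hA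
  obtain ⟨b, hb⟩ := hB
  have h1 : mobius h S = mobius (fun T => h (T ∩ A)) S + mobius (fun T => h (T ∩ B)) S := by
    simp only [mobius]
    rw [← Finset.sum_add_distrib]
    refine Finset.sum_congr rfl fun T hT => ?_
    rw [hadd T (Finset.mem_powerset.1 hT), mul_add]
  rw [h1, mobius_eq_zero_of_insert (v := b), mobius_eq_zero_of_insert (v := a), add_zero]
  · rw [hS]; exact Finset.mem_union_left _ ha
  · intro T _
    rw [Finset.insert_inter_of_notMem (Finset.disjoint_left.1 hd ha)]
  · rw [hS]; exact Finset.mem_union_right _ hb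
  · intro T _
    rw [Finset.insert_inter_of_notMem (Finset.disjoint_right.1 hd hb)]

theorem sum_powerset_map {W : Type*} (f : V ↪ W) (S : Finset V) (g : Finset W → ℝ) :
    ∑ T ∈ (S.map f).powerset, g T = ∑ T ∈ S.powerset, g (T.map f) := by
  symm
  refine Finset.sum_bij (fun T _ => T.map f) ?_ ?_ ?_ fun _ _ => rfl
  · intro T hT
    rw [Finset.mem_powerset] at hT ⊢
    exact Finset.map_subset_map.2 hT
  · intro T _ T' _ h
    exact Finset.map_injective f h
  · intro T hT
    rw [Finset.mem_powerset, Finset.subset_map_iff] at hT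
    obtain ⟨U, hU, rfl⟩ := hT
    exact ⟨U, Finset.mem_powerset.2 hU, rfl⟩

theorem mobius_map {W : Type*} (f : V ↪ W) {g : Finset V → ℝ} {h : Finset W → ℝ} (S : Finset V)
    (hgh : ∀ T ⊆ S, h (T.map f) = g T) : mobius h (S.map f) = mobius g S := by
  rw [mobius, sum_powerset_map, mobius]
  refine Finset.sum_congr rfl fun T hT => ?_
  rw [Finset.card_map, Finset.card_map, hgh T (Finset.mem_powerset.1 hT)]

end Mobius

/-! ### Locality of the logarithmic coefficients -/

section Locality

open Polynomial Classical

variable {V : Type*} [Fintype V] {G : SimpleGraph V}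

theorem incCount_union {V : Type*} {A B : Finset (Sym2 V)} (h : Disjoint A B) (v : V) :
    incCount (A ∪ B) v = incCount A v + incCount B v := by
  rw [incCount, Finset.filter_union, Finset.card_union_of_disjoint]
  · rfl
  · exact Finset.disjoint_filter_filter h

theorem incCount_eq_zero {S : Finset V} {A : Finset (Sym2 V)} (hA : A ⊆ edgesIn G S) {v : V}
    (hv : v ∉ S) : incCount A v = 0 := by
  rw [incCount, Finset.card_eq_zero, Finset.filter_eq_empty_iff]
  intro e he hve
  exact hv ((Finset.mem_filter.1 (hA he)).2 v hve)

theorem disjoint_edgesIn {S T : Finset V} (h : Disjoint S T) :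
    Disjoint (edgesIn G S) (edgesIn G T) := by
  rw [Finset.disjoint_left]
  intro e he he'
  induction e using Sym2.ind with
  | _ a b =>
    exact Finset.disjoint_left.1 h ((Finset.mem_filter.1 he).2 a (Sym2.mem_mk_left a b))
      ((Finset.mem_filter.1 he').2 a (Sym2.mem_mk_left a b))

/-- Degrees are those of the whole graph G, whatever S and T are, and a vertex not met by the edge
set has weight 1; hence exact multiplicativity. -/
theorem edgeWeight_union {S T : Finset V} (h : Disjoint S T) {A B : Finset (Sym2 V)}
    (hA : A ⊆ edgesIn G S) (hB : B ⊆ edgesIn G T) :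
    edgeWeight G (A ∪ B) = edgeWeight G A * edgeWeight G B := by
  have hd : Disjoint A B := (disjoint_edgesIn h).mono hA hB
  rw [edgeWeight, edgeWeight, edgeWeight, Finset.card_union_of_disjoint hd, pow_add,
    mul_mul_mul_comm, ← Finset.prod_mul_distrib]
  congr 1
  refine Finset.prod_congr rfl fun v _ => ?_
  rw [incCount_union hd]
  by_cases hv : v ∈ S
  · rw [incCount_eq_zero hB (Finset.disjoint_left.1 h hv), vertexWeight_zero_right, add_zero,
      mul_one]
  · rw [incCount_eq_zero hA hv, vertexWeight_zero_right, zero_add, one_mul]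

theorem edgesIn_union {S T : Finset V} (hST : ∀ a ∈ S, ∀ b ∈ T, ¬ G.Adj a b) :
    edgesIn G (S ∪ T) = edgesIn G S ∪ edgesIn G T := by
  ext e
  induction e using Sym2.ind with
  | _ a b =>
    simp only [edgesIn, Finset.mem_filter, Finset.mem_union, SimpleGraph.mem_edgeFinset,
      SimpleGraph.mem_edgeSet, Sym2.mem_iff, forall_eq_or_imp, forall_eq]
    constructor
    · rintro ⟨h, ha | ha, hb | hb⟩
      · exact Or.inl ⟨h, ha, hb⟩
      · exact absurd h (hST a ha b hb)
      · exact absurd h.symm (hST b hb a ha)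
      · exact Or.inr ⟨h, ha, hb⟩
    · rintro (⟨h, ha, hb⟩ | ⟨h, ha, hb⟩)
      · exact ⟨h, Or.inl ha, Or.inl hb⟩
      · exact ⟨h, Or.inr ha, Or.inr hb⟩

theorem sum_powerset_union {α : Type*} [DecidableEq α] {A B : Finset α} (h : Disjoint A B)
    {M : Type*} [AddCommMonoid M] (g : Finset α → M) :
    ∑ C ∈ (A ∪ B).powerset, g C = ∑ C ∈ A.powerset, ∑ D ∈ B.powerset, g (C ∪ D) := by
  rw [← Finset.sum_product']
  symm
  refine Finset.sum_bij (fun p _ => p.1 ∪ p.2) ?_ ?_ ?_ fun _ _ => rfl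
  · rintro ⟨C, D⟩ hp
    simp only [Finset.mem_product, Finset.mem_powerset] at hp ⊢
    exact Finset.union_subset_union hp.1 hp.2
  · rintro ⟨C, D⟩ hp ⟨C', D'⟩ hp' he
    simp only [Finset.mem_product, Finset.mem_powerset] at hp hp' he
    have key : ∀ {X Y : Finset α}, X ⊆ A → Y ⊆ B → (X ∪ Y) ∩ A = X ∧ (X ∪ Y) ∩ B = Y := by
      intro X Y hX hY
      rw [Finset.disjoint_left] at h
      constructor <;> ext a <;> simp only [Finset.mem_inter, Finset.mem_union]
      · exact ⟨fun ⟨h1, h2⟩ => h1.resolve_right fun h3 => h h2 (hY h3), fun h1 => ⟨Or.inl h1, hX h1⟩⟩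
      · exact ⟨fun ⟨h1, h2⟩ => h1.resolve_left fun h3 => h (hX h3) h2, fun h1 => ⟨Or.inr h1, hY h1⟩⟩
    have h1 := key hp.1 hp.2
    have h2 := key hp'.1 hp'.2
    rw [he] at h1
    rw [← h1.1, ← h1.2, h2.1, h2.2]
  · intro C hC
    rw [Finset.mem_powerset] at hC
    refine ⟨(C ∩ A, C ∩ B), ?_, ?_⟩
    · simp only [Finset.mem_product, Finset.mem_powerset]
      exact ⟨Finset.inter_subset_right, Finset.inter_subset_right⟩
    · rw [← Finset.inter_union_distrib_left]
      exact Finset.inter_eq_left.2 hC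

theorem genPoly_union {S T : Finset V} (h : Disjoint S T)
    (hST : ∀ a ∈ S, ∀ b ∈ T, ¬ G.Adj a b) :
    genPoly G (S ∪ T) = genPoly G S * genPoly G T := by
  rw [genPoly, edgesIn_union hST, sum_powerset_union (disjoint_edgesIn h), genPoly, genPoly,
    Finset.sum_mul_sum]
  refine Finset.sum_congr rfl fun A hA => Finset.sum_congr rfl fun B hB => ?_
  rw [Finset.mem_powerset] at hA hB
  rw [edgeWeight_union h hA hB,
    Finset.card_union_of_disjoint ((disjoint_edgesIn h).mono hA hB), C_mul, pow_add]
  ring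

theorem genPoly_empty : genPoly G ∅ = 1 := by
  have : edgesIn G ∅ = ∅ := by
    rw [edgesIn, Finset.filter_eq_empty_iff]
    intro e _ he
    induction e using Sym2.ind with
    | _ a b => simpa using he a (Sym2.mem_mk_left a b)
  rw [genPoly, this]
  simp [edgeWeight_empty]

/-- A set of j edges counts exactly when S contains its endpoints, of which there are at most 2j. -/
theorem coeff_genPoly_mem_degreeLE (j : ℕ) :
    (fun S => (genPoly G S).coeff j) ∈ degreeLE V (2 * j) := by
  have h : (fun S => (genPoly G S).coeff j) = ∑ A ∈ G.edgeFinset.powersetCard j, edgeWeight G A •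
      fun S : Finset V => if (A.biUnion Sym2.toFinset) ⊆ S then (1 : ℝ) else 0 := by
    funext S
    rw [coeff_genPoly, Finset.sum_apply]
    simp only [Pi.smul_apply, smul_eq_mul, mul_ite, mul_one, mul_zero]
    rw [← Finset.sum_filter]
    refine Finset.sum_congr ?_ fun _ _ => rfl
    ext A
    simp only [Finset.mem_powersetCard, Finset.mem_filter, Finset.biUnion_subset]
    constructor
    · rintro ⟨h1, h2⟩
      refine ⟨⟨h1.trans (Finset.filter_subset _ _), h2⟩, fun e he v hv => ?_⟩
      exact (Finset.mem_filter.1 (h1 he)).2 v (Sym2.mem_toFinset.1 hv)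
    · rintro ⟨⟨h1, h2⟩, h3⟩
      refine ⟨fun e he => Finset.mem_filter.2 ⟨h1 he, fun v hv => ?_⟩, h2⟩
      exact h3 e he (Sym2.mem_toFinset.2 hv)
  rw [h]
  refine Submodule.sum_mem _ fun A hA => Submodule.smul_mem _ _ (Submodule.subset_span ⟨_, ?_, rfl⟩)
  rw [Finset.mem_powersetCard] at hA
  refine (Finset.card_biUnion_le_card_mul _ _ 2 fun e _ => ?_).trans_eq (by rw [hA.2, mul_comm])
  by_cases he : e.IsDiag
  · rw [Sym2.card_toFinset_of_isDiag e he]; norm_num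
  · rw [Sym2.card_toFinset_of_not_isDiag e he]

theorem logCoeff_genPoly_mem_degreeLE (k : ℕ) :
    (fun S => logCoeff (genPoly G S) k) ∈ degreeLE V (2 * k + 2) := by
  induction k using Nat.strong_induction_on with
  | _ k ih =>
    have h : (fun S => logCoeff (genPoly G S) k) =
        ((k : ℝ) + 1) • (fun S => (genPoly G S).coeff (k + 1)) -
          ∑ i ∈ Finset.range k, (fun S => logCoeff (genPoly G S) i) *
            fun S => (genPoly G S).coeff (k - i) := by
      funext S
      rw [logCoeff_recursion (coeff_zero_genPoly S)]
      simp [Finset.sum_apply]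
    rw [h]
    refine Submodule.sub_mem _ (Submodule.smul_mem _ _
      (degreeLE_mono (by omega) (coeff_genPoly_mem_degreeLE (k + 1))))
      (Submodule.sum_mem _ fun i hi => ?_)
    rw [Finset.mem_range] at hi
    exact degreeLE_mono (by omega)
      (mul_mem_degreeLE (ih i hi) (coeff_genPoly_mem_degreeLE (G := G) (k - i)))

variable (G) in
/-- The connected contribution of a vertex set to the `k`-th logarithmic coefficient. -/
noncomputable def cumulant (k : ℕ) (S : Finset V) : ℝ :=
  mobius (fun T => logCoeff (genPoly G T) k) S

theorem cumulant_eq_zero_of_card {k : ℕ} {S : Finset V} (hS : 2 * k + 2 < S.card) :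
    cumulant G k S = 0 :=
  mobius_eq_zero_of_mem_degreeLE (logCoeff_genPoly_mem_degreeLE k) hS

theorem cumulant_empty (k : ℕ) : cumulant G k ∅ = 0 := by
  simp [cumulant, mobius, genPoly_empty, logCoeff_one]

theorem cumulant_eq_zero_of_separated {k : ℕ} {S A B : Finset V} (hS : S = A ∪ B)
    (hd : Disjoint A B) (hA : A.Nonempty) (hB : B.Nonempty)
    (hAB : ∀ a ∈ A, ∀ b ∈ B, ¬ G.Adj a b) : cumulant G k S = 0 := by
  refine mobius_eq_zero_of_additive hS hd hA hB fun T hT => ?_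
  rw [← logCoeff_mul (coeff_zero_genPoly _) (coeff_zero_genPoly _), ← genPoly_union,
    ← Finset.inter_union_distrib_left, ← hS, Finset.inter_eq_left.2 hT]
  · exact hd.mono Finset.inter_subset_right Finset.inter_subset_right
  · exact fun a ha b hb => hAB a (Finset.mem_inter.1 ha).2 b (Finset.mem_inter.1 hb).2

theorem cumulant_eq_zero_of_far {k : ℕ} {S : Finset V} {v w : V} (hv : v ∈ S) (hw : w ∈ S)
    (hvw : ((2 * k + 2 : ℕ) : ℕ∞) < G.edist v w) : cumulant G k S = 0 := by
  set R := 2 * k + 2 with hR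
  by_cases hcard : R < S.card
  · exact cumulant_eq_zero_of_card hcard
  -- S has at most R elements, one of them v at distance 0, so some sphere of radius between 1 and R
  -- misses S. Cutting there separates v from w, since adjacent vertices differ by at most 1 in
  -- distance from v.
  have hgap : ∃ j ∈ Finset.Icc 1 R, ∀ x ∈ S, G.edist v x ≠ (j : ℕ∞) := by
    have : Nonempty V := ⟨v⟩
    by_contra! hcon
    choose! f hf using hcon
    have hle : (Finset.Icc 1 R).card ≤ (S.erase v).card := by
      refine Finset.card_le_card_of_injOn f ?_ ?_
      · intro j hj
        have hj' : j ∈ Finset.Icc 1 R := hj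
        refine Finset.mem_coe.2 (Finset.mem_erase.2 ⟨?_, (hf j hj').1⟩)
        intro h
        have h2 := (hf j hj').2
        rw [h, SimpleGraph.edist_self] at h2
        have h3 : 0 = j := by exact_mod_cast h2
        rw [← h3] at hj'
        simp at hj'
      · intro i hi j hj hij
        have h1 := (hf i hi).2
        have h2 := (hf j hj).2
        rw [hij, h2] at h1
        exact_mod_cast h1.symm
    rw [Nat.card_Icc, Finset.card_erase_of_mem hv] at hle
    have := Finset.card_pos.2 ⟨v, hv⟩
    omega
  obtain ⟨j, hj, hjS⟩ := hgap
  rw [Finset.mem_Icc] at hj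
  refine cumulant_eq_zero_of_separated (A := S.filter fun x => G.edist v x < j)
    (B := S.filter fun x => (j : ℕ∞) < G.edist v x) ?_ ?_ ⟨v, ?_⟩ ⟨w, ?_⟩ ?_
  · ext x
    simp only [Finset.mem_union, Finset.mem_filter]
    exact ⟨fun h => (lt_or_gt_of_ne (hjS x h)).imp (fun h' => ⟨h, h'⟩) fun h' => ⟨h, h'⟩,
      fun h => h.elim And.left And.left⟩
  · rw [Finset.disjoint_filter]
    exact fun x _ h => not_lt_of_gt h
  · rw [Finset.mem_filter, SimpleGraph.edist_self]
    exact ⟨hv, by exact_mod_cast hj.1⟩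
  · rw [Finset.mem_filter]
    exact ⟨hw, lt_of_le_of_lt (by exact_mod_cast hj.2) hvw⟩
  · intro a ha b hb hab
    have h1 := (Finset.mem_filter.1 ha).2
    have h2 := (Finset.mem_filter.1 hb).2
    have h3 : G.edist v b ≤ G.edist v a + G.edist a b := SimpleGraph.edist_triangle
    rw [SimpleGraph.edist_eq_one_iff_adj.2 hab] at h3
    exact absurd (h2.trans_le (h3.trans (Order.add_one_le_of_lt h1))) (lt_irrefl _)

variable (G) in
/-- The share of a vertex in the `k`-th logarithmic coefficient of the generating polynomial. -/
noncomputable def vertexShare (k : ℕ) (v : V) : ℝ :=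
  ∑ S : Finset V with v ∈ S, cumulant G k S / S.card

/-- Möbius inversion at the full vertex set, with each cumulant split equally among the vertices of
its set. -/
theorem sum_vertexShare (k : ℕ) :
    ∑ v, vertexShare G k v = logCoeff (genPoly G Finset.univ) k := by
  have h := sum_mobius (fun T => logCoeff (genPoly G T) k) (Finset.univ : Finset V)
  rw [← h]
  simp only [vertexShare, Finset.sum_filter]
  rw [Finset.sum_comm, Finset.powerset_univ]
  refine Finset.sum_congr rfl fun S _ => ?_
  rw [← Finset.sum_filter, Finset.filter_mem_eq_inter, Finset.univ_inter, Finset.sum_const,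
    nsmul_eq_mul]
  rcases S.eq_empty_or_nonempty with rfl | hS
  · rw [show mobius (fun T => logCoeff (genPoly G T) k) ∅ = 0 from cumulant_empty k]; simp
  · have : (S.card : ℝ) ≠ 0 := Nat.cast_ne_zero.2 (Finset.card_pos.2 hS).ne'
    rw [mul_div_cancel₀ _ this]
    rfl

variable {W : Type*} [Fintype W] {H : SimpleGraph W}

theorem edgesIn_map (f : G ↪g H) (S : Finset V) :
    edgesIn H (S.map f.toEmbedding) = (edgesIn G S).map f.toEmbedding.sym2Map := by
  ext e
  induction e using Sym2.ind with
  | _ a b =>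
    simp only [edgesIn, Finset.mem_filter, SimpleGraph.mem_edgeFinset, SimpleGraph.mem_edgeSet,
      Sym2.mem_iff, forall_eq_or_imp, forall_eq, Finset.mem_map]
    constructor
    · rintro ⟨hab, ⟨x, hx, rfl⟩, ⟨y, hy, rfl⟩⟩
      refine ⟨s(x, y), ⟨?_, ?_⟩, rfl⟩
      · exact f.map_adj_iff.1 hab
      · intro v hv
        rcases Sym2.mem_iff.1 hv with rfl | rfl <;> assumption
    · rintro ⟨e, ⟨he, hS⟩, hab⟩
      induction e using Sym2.ind with
      | _ x y =>
        have h1 : H.Adj (f x) (f y) := f.map_adj_iff.2 (by simpa using he)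
        have hx := hS x (Sym2.mem_mk_left x y)
        have hy := hS y (Sym2.mem_mk_right x y)
        have h2 : s(f x, f y) = s(a, b) := hab
        rcases Sym2.eq_iff.1 h2 with ⟨rfl, rfl⟩ | ⟨rfl, rfl⟩
        · exact ⟨h1, ⟨x, hx, rfl⟩, ⟨y, hy, rfl⟩⟩
        · exact ⟨h1.symm, ⟨y, hy, rfl⟩, ⟨x, hx, rfl⟩⟩

theorem incCount_map {V W : Type*} (f : V ↪ W) (A : Finset (Sym2 V)) (v : V) :
    incCount (A.map f.sym2Map) (f v) = incCount A v := by
  rw [incCount, Finset.filter_map, Finset.card_map, incCount]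
  congr 1
  refine Finset.filter_congr fun e _ => ?_
  simp only [Function.comp_apply, Function.Embedding.sym2Map_apply, Sym2.mem_map]
  constructor
  · rintro ⟨a, ha, h⟩
    rwa [← f.injective h]
  · exact fun h => ⟨v, h, rfl⟩

/-- Vertices outside S are met by no edge of A and have weight 1, so degrees need to agree only on
S. This allows a ball to replace the graph although degrees drop at its boundary. -/
theorem edgeWeight_map (f : G ↪g H) {S : Finset V} (hdeg : ∀ a ∈ S, H.degree (f a) = G.degree a)
    {A : Finset (Sym2 V)} (hA : A ⊆ edgesIn G S) :
    edgeWeight H (A.map f.toEmbedding.sym2Map) = edgeWeight G A := by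
  rw [edgeWeight, edgeWeight, Finset.card_map]
  congr 1
  rw [← Finset.prod_subset (Finset.subset_univ (Finset.univ.map f.toEmbedding)), Finset.prod_map]
  · refine Finset.prod_congr rfl fun v _ => ?_
    rw [incCount_map]
    by_cases hv : v ∈ S
    · rw [← hdeg v hv]; rfl
    · rw [incCount_eq_zero hA hv, vertexWeight_zero_right, vertexWeight_zero_right]
  · intro w _ hw
    rw [show incCount (A.map f.toEmbedding.sym2Map) w = 0 from ?_, vertexWeight_zero_right]
    rw [incCount, Finset.card_eq_zero, Finset.filter_eq_empty_iff]
    intro e he hwe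
    obtain ⟨e', -, rfl⟩ := Finset.mem_map.1 he
    obtain ⟨a, -, rfl⟩ := Sym2.mem_map.1 hwe
    exact hw (Finset.mem_map_of_mem _ (Finset.mem_univ a))

theorem genPoly_map (f : G ↪g H) {S : Finset V}
    (hdeg : ∀ a ∈ S, H.degree (f a) = G.degree a) :
    genPoly H (S.map f.toEmbedding) = genPoly G S := by
  ext j
  rw [coeff_genPoly, coeff_genPoly, edgesIn_map, Finset.powersetCard_map, Finset.sum_map]
  refine Finset.sum_congr rfl fun A hA => ?_
  exact edgeWeight_map f hdeg (Finset.mem_powersetCard.1 hA).1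

theorem cumulant_map (f : G ↪g H) {S : Finset V}
    (hdeg : ∀ a ∈ S, H.degree (f a) = G.degree a) (k : ℕ) :
    cumulant H k (S.map f.toEmbedding) = cumulant G k S :=
  mobius_map _ _ fun T hT => by rw [genPoly_map f fun a ha => hdeg a (hT ha)]

theorem vertexShare_eq_sum_near {k R : ℕ} (hk : 2 * k + 2 ≤ R) (v : V) :
    vertexShare G k v =
      ∑ S ∈ (Finset.univ.filter fun w => G.edist v w ≤ R).powerset,
        if v ∈ S then cumulant G k S / S.card else 0 := by
  have hkR : ((2 * k + 2 : ℕ) : ℕ∞) ≤ R := by exact_mod_cast hk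
  rw [vertexShare, Finset.sum_filter]
  symm
  refine Finset.sum_subset (Finset.subset_univ _) fun S _ hS => ?_
  split_ifs with hv
  · rw [Finset.mem_powerset, Finset.not_subset] at hS
    obtain ⟨w, hw, hfar⟩ := hS
    rw [Finset.mem_filter, not_and] at hfar
    rw [cumulant_eq_zero_of_far hv hw
      (hkR.trans_lt (not_le.1 (hfar (Finset.mem_univ w)))), zero_div]
  · rfl

/-- An embedding that identifies the balls around `r` and `f r`, with their degrees. -/
def IsLocalIso (f : G ↪g H) (r : V) (R : ℕ) : Prop :=
  (∀ a, G.edist r a ≤ R → H.degree (f a) = G.degree a) ∧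
    ∀ w, H.edist (f r) w ≤ R → ∃ a, f a = w ∧ G.edist r a ≤ R

theorem edist_map_le {V W : Type*} {G : SimpleGraph V} {H : SimpleGraph W} (f : G ↪g H) (a b : V) : H.edist (f a) (f b) ≤ G.edist a b := by
  by_cases h : G.edist a b = ⊤
  · rw [h]; exact le_top
  · obtain ⟨p, hp⟩ := SimpleGraph.exists_walk_of_edist_ne_top h
    rw [← hp, ← SimpleGraph.Walk.length_map f.toHom p]
    exact SimpleGraph.Walk.edist_le _

theorem vertexShare_eq_of_isLocalIso (f : G ↪g H) {r : V} {R k : ℕ} (hf : IsLocalIso f r R)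
    (hk : 2 * k + 2 ≤ R) : vertexShare H k (f r) = vertexShare G k r := by
  have hball : (Finset.univ.filter fun w => H.edist (f r) w ≤ R) =
      (Finset.univ.filter fun a => G.edist r a ≤ R).map f.toEmbedding := by
    ext w
    simp only [Finset.mem_filter, Finset.mem_univ, true_and, Finset.mem_map]
    constructor
    · intro hw
      obtain ⟨a, rfl, ha⟩ := hf.2 w hw
      exact ⟨a, ha, rfl⟩
    · rintro ⟨a, ha, rfl⟩
      exact (edist_map_le f r a).trans ha
  rw [vertexShare_eq_sum_near hk, vertexShare_eq_sum_near hk, hball, sum_powerset_map]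
  refine Finset.sum_congr rfl fun S hS => ?_
  have hmem : f r ∈ S.map f.toEmbedding ↔ r ∈ S := Finset.mem_map' f.toEmbedding
  rw [cumulant_map f fun a ha => hf.1 a (Finset.mem_filter.1 (Finset.mem_powerset.1 hS ha)).2,
    Finset.card_map]
  simp only [hmem]

end Locality

end EulerOr

namespace EulerOr

/-! ### Local approximation of the entropy -/

section LocalEntropy

open Polynomial Classical

/-- The contribution of a vertex to the truncated logarithm of the number of Eulerian
orientations. -/
noncomputable def localEntropy {V : Type*} [Fintype V] (G : SimpleGraph V) (x : ℝ) (K : ℕ)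
    (v : V) : ℝ :=
  Real.log ((G.degree v).choose (G.degree v / 2)) - (G.degree v : ℝ) / 2 * Real.log 2 +
    ∑ k ∈ Finset.range K, vertexShare G k v * x ^ (k + 1) / (k + 1)

theorem localEntropy_eq_of_isLocalIso {V W : Type*} [Fintype V] [Fintype W] {G : SimpleGraph V}
    {H : SimpleGraph W} (f : G ↪g H) {r : V} {x : ℝ} {K : ℕ} (hf : IsLocalIso f r (2 * K)) :
    localEntropy H x K (f r) = localEntropy G x K r := by
  rw [localEntropy, localEntropy, hf.1 r (by rw [SimpleGraph.edist_self]; exact zero_le)]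
  congr 1
  refine Finset.sum_congr rfl fun k hk => ?_
  rw [vertexShare_eq_of_isLocalIso f hf (by have := Finset.mem_range.1 hk; omega)]

theorem isLocalIso_of_iso {V W : Type*} [Fintype V] [Fintype W] {G : SimpleGraph V}
    {H : SimpleGraph W} (e : G ≃g H) (r : V) (R : ℕ) : IsLocalIso e.toEmbedding r R := by
  refine ⟨fun a _ => e.degree_eq a, fun w hw => ⟨e.symm w, e.apply_symm_apply w, ?_⟩⟩
  have h := edist_map_le e.symm.toEmbedding (e r) w
  have h1 : e.symm.toEmbedding (e r) = r := e.symm_apply_apply r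
  rw [h1] at h
  exact h.trans hw

/-- The contribution of the root of a rooted graph. -/
noncomputable def RootedGraph.rootEntropy (A : RootedGraph.{u}) (x : ℝ) (K : ℕ) : ℝ :=
  letI := Fintype.ofFinite A.V
  localEntropy A.graph x K A.root

theorem RootedGraph.IsIso.rootEntropy_eq {A B : RootedGraph.{u}} (h : A.IsIso B) (x : ℝ) (K : ℕ) :
    A.rootEntropy x K = B.rootEntropy x K := by
  obtain ⟨e, he⟩ := h
  let _ := Fintype.ofFinite A.V
  let _ := Fintype.ofFinite B.V
  have := localEntropy_eq_of_isLocalIso e.toEmbedding (x := x) (K := K)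
    (isLocalIso_of_iso e A.root (2 * K))
  rw [RootedGraph.rootEntropy, RootedGraph.rootEntropy, ← he]
  exact this.symm

theorem FinGraph.exists_walk_ball_of_le (G : FinGraph.{u}) (v : G.V) {R r : ℕ} (hR : R ≤ r)
    {w : G.V} (hw : G.graph.edist v w ≤ R) (hwr : w ∈ G.ballSet v r) :
    ∃ p : (G.graph.induce (G.ballSet v r)).Walk ⟨v, G.self_mem_ballSet v r⟩ ⟨w, hwr⟩,
      p.length ≤ R := by
  obtain ⟨p, hp⟩ := SimpleGraph.exists_walk_of_edist_ne_top
    (ne_top_of_le_ne_top (ENat.natCast_ne_top R) hw)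
  have hp' : p.length ≤ R := by
    rw [← hp] at hw
    exact_mod_cast hw
  have hs : ∀ x ∈ p.support, x ∈ G.ballSet v r := by
    intro x hx
    have h1 : G.graph.edist v x ≤ ((p.takeUntil x hx).length : ℕ∞) :=
      SimpleGraph.Walk.edist_le _
    have h2 : (p.takeUntil x hx).length ≤ r :=
      (p.length_takeUntil_le_length hx).trans (hp'.trans hR)
    exact h1.trans (by exact_mod_cast h2)
  refine ⟨p.induce _ hs, ?_⟩
  rw [← SimpleGraph.Walk.length_map (SimpleGraph.Embedding.induce _).toHom,
    SimpleGraph.Walk.map_induce]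
  exact hp'

/-- The extra unit of radius keeps all neighbours of vertices at distance at most R, hence their
degrees. -/
theorem FinGraph.isLocalIso_ball (G : FinGraph.{u}) (v : G.V) (R : ℕ)
    [Fintype (G.ballSet v (R + 1))] :
    IsLocalIso (SimpleGraph.Embedding.induce (G := G.graph) (G.ballSet v (R + 1)))
      ⟨v, G.self_mem_ballSet v (R + 1)⟩ R := by
  constructor
  · intro a ha
    have h1 := (edist_map_le (SimpleGraph.Embedding.induce (G := G.graph) (G.ballSet v (R + 1)))
      ⟨v, G.self_mem_ballSet v (R + 1)⟩ a).trans ha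
    have h2 : G.graph.edist v a ≤ R := h1
    have h3 : ∀ w, G.graph.Adj a w → w ∈ G.ballSet v (R + 1) := by
      intro w hw
      have h4 : G.graph.edist v w ≤ G.graph.edist v a + G.graph.edist a w :=
        SimpleGraph.edist_triangle
      rw [SimpleGraph.edist_eq_one_iff_adj.2 hw] at h4
      refine h4.trans ?_
      push_cast
      gcongr
    rw [← SimpleGraph.card_neighborFinset_eq_degree, ← SimpleGraph.card_neighborFinset_eq_degree,
      ← Finset.card_map (Function.Embedding.subtype _)]
    congr 1
    ext w
    simp only [SimpleGraph.mem_neighborFinset, Finset.mem_map, Function.Embedding.subtype_apply]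
    exact ⟨fun h => ⟨⟨w, h3 w h⟩, h, rfl⟩, by rintro ⟨b, hb, rfl⟩; exact hb⟩
  · intro w hw
    have hw' : G.graph.edist v w ≤ R := hw
    have hmem : w ∈ G.ballSet v (R + 1) := hw'.trans (by exact_mod_cast Nat.le_succ R)
    obtain ⟨p, hp⟩ := G.exists_walk_ball_of_le v (Nat.le_succ R) hw' hmem
    exact ⟨⟨w, hmem⟩, rfl, (SimpleGraph.Walk.edist_le p).trans (by exact_mod_cast hp)⟩

/-- The contribution of the root, as a function of neighbourhoods. -/
noncomputable def neighbourhoodEntropy (x : ℝ) (K r : ℕ) : Neighbourhood.{u} r → ℝ :=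
  Quotient.lift (fun A => A.1.rootEntropy x K) fun _ _ h => RootedGraph.IsIso.rootEntropy_eq h x K

theorem FinGraph.neighbourhoodEntropy_neighbourhood (G : FinGraph.{u}) (x : ℝ) (K : ℕ) (v : G.V) :
    neighbourhoodEntropy x K (2 * K + 1) (G.neighbourhood (2 * K + 1) v) =
      localEntropy G.graph x K v := by
  let _ : Fintype (G.ballSet v (2 * K + 1)) := Fintype.ofFinite (G.ball v (2 * K + 1)).V
  exact (localEntropy_eq_of_isLocalIso _ (G.isLocalIso_ball v (2 * K))).symm

theorem FinGraph.card_edgeFinset_le {G : FinGraph.{u}} {Δ : ℕ} (hΔ : G.MaxDegLE Δ) :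
    G.graph.edgeFinset.card ≤ Δ * G.order := by
  have h1 := G.two_mul_card_edgeFinset
  have h2 : ∑ v, G.deg v ≤ ∑ _v : G.V, Δ := Finset.sum_le_sum fun v _ => hΔ v
  rw [Finset.sum_const, Finset.card_univ, smul_eq_mul, mul_comm] at h2
  rw [FinGraph.order, Nat.card_eq_fintype_card]
  omega

theorem FinGraph.order_pos (G : FinGraph.{u}) : 0 < G.order := Nat.card_pos

/-- The first error term comes from replacing F(1) by F(x), the second from truncating log F(x). -/
theorem FinGraph.abs_log_sub_sum_localEntropy_le (G : FinGraph.{u}) (hG : G.IsEulerian) {x : ℝ}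
    (hx0 : 0 < x) (hx1 : x < 1) (K : ℕ) :
    |Real.log G.numEulerianOrientations - ∑ v, localEntropy G.graph x K v| ≤
      G.graph.edgeFinset.card * (-Real.log x + x ^ (K + 1) / (1 - x)) := by
  set e := G.graph.edgeFinset.card
  have h1 := abs_log_eval_sub_sum_logCoeff_le (coeff_zero_genPoly (G := G.graph) Finset.univ)
    (fun z hz => aeval_genPoly_ne_zero hz) hx0.le hx1 K
  obtain ⟨h2, h3, h4⟩ := eval_genPoly_le (G := G.graph) hG hx0.le hx1.le
  set F := genPoly G.graph Finset.univ
  have hdeg : (F.natDegree : ℝ) ≤ e := Nat.cast_le.2 (natDegree_genPoly_le _)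
  have hpos : 0 < F.eval x := by linarith
  have hpos1 : 0 < F.eval 1 := by linarith
  have h5 : Real.log (F.eval x) ≤ Real.log (F.eval 1) := Real.log_le_log hpos h2
  have h6 : e * Real.log x + Real.log (F.eval 1) ≤ Real.log (F.eval x) := by
    rw [← Real.log_pow, ← Real.log_mul (by positivity) hpos1.ne']
    exact Real.log_le_log (by positivity) h3
  have h7 : ∑ v, localEntropy G.graph x K v =
      ∑ v, (Real.log ((G.deg v).choose (G.deg v / 2)) - (G.deg v : ℝ) / 2 * Real.log 2) +
        ∑ k ∈ Finset.range K, logCoeff F k * x ^ (k + 1) / (k + 1) := by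
    simp only [localEntropy]
    rw [Finset.sum_add_distrib, Finset.sum_comm]
    congr 1
    refine Finset.sum_congr rfl fun k _ => ?_
    rw [← sum_vertexShare, Finset.sum_mul, Finset.sum_div]
  rw [h7, G.log_numEulerianOrientations hG, add_sub_add_left_eq_sub]
  have h8 : (F.natDegree : ℝ) * (x ^ (K + 1) / (1 - x)) ≤ e * (x ^ (K + 1) / (1 - x)) := by
    have : 0 < 1 - x := by linarith
    gcongr
  have h9 := abs_le.1 (h1.trans h8)
  rw [abs_le, mul_add]
  constructor <;> nlinarith [h9.1, h9.2]

theorem exists_local_approximation (Δ : ℕ) {ε : ℝ} (hε : 0 < ε) :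
    ∃ r : ℕ, 0 < r ∧ ∃ ψ : Neighbourhood.{u} r → ℝ, ∀ G : FinGraph.{u}, G.IsEulerian →
      G.MaxDegLE Δ → |G.entropy - (∑ v, ψ (G.neighbourhood r v)) / G.order| ≤ ε := by
  -- Chosen to make -log x half of ε / (Δ + 1); K then makes the truncation term at most the other
  -- half. There are at most Δ edges per vertex, and Δ + 1 avoids division by zero.
  set x := Real.exp (-(ε / (2 * (Δ + 1)))) with hx
  have hc : 0 < ε / (2 * ((Δ : ℝ) + 1)) := by positivity
  have hx0 : 0 < x := Real.exp_pos _
  have hx1 : x < 1 := by rw [hx, Real.exp_lt_one_iff]; linarith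
  have hlog : -Real.log x = ε / (2 * (Δ + 1)) := by rw [hx, Real.log_exp, neg_neg]
  have h1x : 0 < 1 - x := by linarith
  obtain ⟨K, hK⟩ := exists_pow_lt_of_lt_one (mul_pos hc h1x) hx1
  refine ⟨2 * K + 1, by omega, neighbourhoodEntropy x K (2 * K + 1), fun G hG hΔ => ?_⟩
  simp only [G.neighbourhoodEntropy_neighbourhood]
  have h := G.abs_log_sub_sum_localEntropy_le hG hx0 hx1 K
  have hn : (0 : ℝ) < G.order := Nat.cast_pos.2 G.order_pos
  have hK' : x ^ (K + 1) / (1 - x) ≤ ε / (2 * (Δ + 1)) := by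
    rw [div_le_iff₀ h1x]
    exact (pow_le_pow_of_le_one hx0.le hx1.le (Nat.le_succ K)).trans hK.le
  have hsum : -Real.log x + x ^ (K + 1) / (1 - x) ≤ ε / (Δ + 1) := by
    rw [hlog]
    have : ε / ((Δ : ℝ) + 1) = ε / (2 * (Δ + 1)) + ε / (2 * (Δ + 1)) := by field_simp; ring
    linarith
  have he : (G.graph.edgeFinset.card : ℝ) ≤ Δ * G.order := by
    exact_mod_cast FinGraph.card_edgeFinset_le hΔ
  have hfin : |Real.log G.numEulerianOrientations - ∑ v, localEntropy G.graph x K v| ≤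
      ε * G.order := by
    refine h.trans ((mul_le_mul_of_nonneg_left hsum (Nat.cast_nonneg _)).trans ?_)
    refine (mul_le_mul_of_nonneg_right he (by positivity)).trans ?_
    have : (Δ : ℝ) * G.order * (ε / (Δ + 1)) = ε * G.order * (Δ / (Δ + 1)) := by ring
    rw [this]
    refine mul_le_of_le_one_right (by positivity) ?_
    rw [div_le_one (by positivity)]
    linarith
  have hrw : G.entropy - (∑ v, localEntropy G.graph x K v) / G.order =
      (Real.log G.numEulerianOrientations - ∑ v, localEntropy G.graph x K v) / G.order := by
    rw [FinGraph.entropy]; ring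
  rw [hrw, abs_div, abs_of_pos hn, div_le_iff₀ hn]
  exact hfin

end LocalEntropy

end EulerOr

namespace EulerOr

/-! ### Finitely many neighbourhoods in bounded degree -/

section FinitelyMany

open Classical

/-- A bound for the number of vertices of a ball of radius `r` in a graph of maximum degree
at most `Δ`. -/
def ballBound (Δ : ℕ) : ℕ → ℕ
  | 0 => 1
  | r + 1 => 1 + Δ * ballBound Δ r

theorem FinGraph.ncard_ballSet_le {G : FinGraph.{u}} {Δ : ℕ} (hΔ : G.MaxDegLE Δ) (r : ℕ)
    (v : G.V) : (G.ballSet v r).ncard ≤ ballBound Δ r := by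
  induction r generalizing v with
  | zero =>
    have : G.ballSet v 0 = {v} := by
      ext w
      simp only [FinGraph.ballSet, Nat.cast_zero, nonpos_iff_eq_zero, SimpleGraph.edist_eq_zero_iff,
        Set.mem_ofPred_eq, Set.mem_singleton_iff]
      exact eq_comm
    rw [this, Set.ncard_singleton]
    rfl
  | succ r ih =>
    have hsub : G.ballSet v (r + 1) ⊆
        (insert v ((G.graph.neighborFinset v).biUnion fun a => (G.ballSet a r).toFinset) :
          Finset G.V) := by
      intro w hw
      have hw' : G.graph.edist v w ≤ (r + 1 : ℕ) := hw
      obtain ⟨p, hp⟩ := SimpleGraph.exists_walk_of_edist_ne_top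
        (ne_top_of_le_ne_top (ENat.natCast_ne_top (r + 1)) hw')
      rw [← hp] at hw'
      have hlen : p.length ≤ r + 1 := by exact_mod_cast hw'
      cases p with
      | nil => exact Finset.mem_coe.2 (Finset.mem_insert_self _ _)
      | @cons _ b _ h q =>
        refine Finset.mem_coe.2 (Finset.mem_insert_of_mem (Finset.mem_biUnion.2 ⟨b, ?_,
          Set.mem_toFinset.2 ?_⟩))
        · simpa using h
        · rw [SimpleGraph.Walk.length_cons] at hlen
          exact (SimpleGraph.Walk.edist_le q).trans (by exact_mod_cast Nat.le_of_succ_le_succ hlen)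
    refine (Set.ncard_le_ncard hsub (Finset.finite_toSet _)).trans ?_
    rw [Set.ncard_coe_finset]
    refine (Finset.card_insert_le _ _).trans ?_
    rw [add_comm, ballBound]
    refine Nat.add_le_add_left ((Finset.card_biUnion_le_card_mul _ _ (ballBound Δ r)
      fun a _ => ?_).trans (Nat.mul_le_mul_right _ (hΔ v))) 1
    rw [← Set.ncard_eq_toFinset_card']
    exact ih a

/-- The neighbourhoods that occur in graphs of maximum degree at most `Δ`. -/
def boundedNeighbourhoods (Δ r : ℕ) : Set (Neighbourhood.{u} r) :=
  {q | ∃ G : FinGraph.{u}, G.MaxDegLE Δ ∧ ∃ v, G.neighbourhood r v = q}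

/-- Balls have bounded size, so each class is represented by a rooted graph on some `Fin n` with n
bounded, and this representative determines the class. -/
theorem finite_boundedNeighbourhoods (Δ r : ℕ) : (boundedNeighbourhoods.{u} Δ r).Finite := by
  let X := Σ n : Fin (ballBound Δ r + 1), SimpleGraph (Fin n) × Fin n
  let P : Neighbourhood.{u} r → X → Prop := fun q x =>
    ∃ A : {A : RootedGraph.{u} // A.RadiusLE r}, Quotient.mk _ A = q ∧
      ∃ e : A.1.graph ≃g x.2.1, e A.1.root = x.2.2
  have hex : ∀ q : boundedNeighbourhoods.{u} Δ r, ∃ x : X, P q x := by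
    rintro ⟨q, G, hΔ, v, rfl⟩
    have hcard := G.ncard_ballSet_le hΔ r v
    have : Fintype (G.ballSet v r) := Fintype.ofFinite _
    rw [← Nat.card_coe_set_eq, Nat.card_eq_fintype_card] at hcard
    let e := Fintype.equivFin (G.ballSet v r)
    refine ⟨⟨⟨Fintype.card (G.ballSet v r), Nat.lt_succ_of_le hcard⟩,
      (G.ball v r).graph.map e.toEmbedding, e (G.ball v r).root⟩,
      ⟨G.ball v r, G.ball_radiusLE v r⟩, rfl, SimpleGraph.Iso.map e _, rfl⟩
  choose f hf using hex
  refine Finite.of_injective f fun q q' h => Subtype.ext ?_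
  obtain ⟨A, hA, e, he⟩ := hf q
  have hq' := hf q'
  rw [← h] at hq'
  obtain ⟨B, hB, e', he'⟩ := hq'
  rw [← hA, ← hB]
  refine Quotient.sound ⟨e.trans e'.symm, ?_⟩
  change e'.symm (e A.1.root) = B.1.root
  rw [he, ← he', e'.symm_apply_apply]

theorem exists_bound_of_bounded_degree (Δ r : ℕ) (ψ : Neighbourhood.{u} r → ℝ) :
    ∃ M : ℝ, 0 ≤ M ∧ ∀ G : FinGraph.{u}, G.MaxDegLE Δ → ∀ v, |ψ (G.neighbourhood r v)| ≤ M := by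
  obtain ⟨M, hM⟩ := ((finite_boundedNeighbourhoods.{u} Δ r).image fun q => |ψ q|).bddAbove
  refine ⟨max M 0, le_max_right _ _, fun G hG v => le_max_of_le_left (hM ?_)⟩
  exact ⟨_, ⟨G, hG, v, rfl⟩, rfl⟩

theorem FinGraph.abs_average_le {G : FinGraph.{u}} {h : G.V → ℝ} {M : ℝ} (hM : ∀ v, |h v| ≤ M) :
    |(∑ v, h v) / G.order| ≤ M := by
  have hn : (0 : ℝ) < G.order := Nat.cast_pos.2 G.order_pos
  rw [abs_div, abs_of_pos hn, div_le_iff₀ hn]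
  refine (Finset.abs_sum_le_sum_abs _ _).trans ((Finset.sum_le_sum fun v _ => hM v).trans ?_)
  rw [Finset.sum_const, nsmul_eq_mul, mul_comm, FinGraph.order, Nat.card_eq_fintype_card,
    Finset.card_univ]

/-- Group the vertices by neighbourhood. The index set depends only on Δ and r, so limits can be
taken term by term along a sequence. -/
theorem FinGraph.average_eq_sum_ballProb {G : FinGraph.{u}} {Δ r : ℕ} (hΔ : G.MaxDegLE Δ)
    (ψ : Neighbourhood.{u} r → ℝ) :
    (∑ v, ψ (G.neighbourhood r v)) / G.order =
      ∑ q ∈ (finite_boundedNeighbourhoods.{u} Δ r).toFinset, ψ q * G.ballProb q.out.1 r := by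
  rw [← Finset.sum_fiberwise_of_maps_to (g := fun v => G.neighbourhood r v)
    (t := (finite_boundedNeighbourhoods.{u} Δ r).toFinset)
    (fun v _ => (Set.Finite.mem_toFinset _).2 ⟨G, hΔ, v, rfl⟩), Finset.sum_div]
  refine Finset.sum_congr rfl fun q _ => ?_
  rw [Finset.sum_congr rfl (g := fun _ => ψ q) fun v hv => by rw [(Finset.mem_filter.1 hv).2],
    Finset.sum_const, nsmul_eq_mul, FinGraph.ballProb, mul_comm, mul_div_assoc]
  congr 2
  rw [← Set.ncard_coe_finset]
  congr 2
  ext v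
  simp only [Finset.coe_filter, Finset.mem_univ, true_and, Set.mem_ofPred_eq]
  conv_lhs => rw [← Quotient.out_eq q]
  exact Quotient.eq

end FinitelyMany

/-! ### From local averages to estimability and convergence -/

section Sampling

/-- The variance of a sum of independent centred samples is additive: on adding a sample, the cross
term vanishes because Y sums to 0. -/
theorem sum_sq_sum_sample {V : Type*} [Fintype V] (Y : V → ℝ) (hY : ∑ v, Y v = 0) {M : ℝ}
    (hM : ∀ v, |Y v| ≤ M) (k : ℕ) :
    ∑ x : Fin k → V, (∑ i, Y (x i)) ^ 2 ≤ k * M ^ 2 * (Fintype.card V : ℝ) ^ k := by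
  induction k with
  | zero => simp
  | succ k ih =>
    have hsq : ∑ v, Y v ^ 2 ≤ Fintype.card V * M ^ 2 := by
      rw [← nsmul_eq_mul, ← Finset.card_univ, ← Finset.sum_const]
      exact Finset.sum_le_sum fun v _ => sq_le_sq.2 ((hM v).trans (le_abs_self M))
    have h1 : ∑ x : Fin (k + 1) → V, (∑ i, Y (x i)) ^ 2 =
        (Fintype.card V : ℝ) ^ k * ∑ v, Y v ^ 2 +
          Fintype.card V * ∑ x : Fin k → V, (∑ i, Y (x i)) ^ 2 := by
      rw [← (Fin.consEquiv fun _ : Fin (k + 1) => V).sum_comp, Fintype.sum_prod_type]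
      simp only [Fin.consEquiv_apply, Fin.sum_univ_succ, Fin.cons_zero, Fin.cons_succ, add_sq,
        Finset.sum_add_distrib, Finset.sum_const, Finset.card_univ, nsmul_eq_mul, Fintype.card_fun,
        Fintype.card_fin, Nat.cast_pow, ← Finset.mul_sum, ← Finset.sum_mul, hY]
      ring
    rw [h1]
    calc _ ≤ (Fintype.card V : ℝ) ^ k * (Fintype.card V * M ^ 2) +
          Fintype.card V * (k * M ^ 2 * (Fintype.card V : ℝ) ^ k) := by gcongr
      _ = _ := by push_cast; ring

theorem ncard_lt_abs_mul_sq_le {α : Type*} [Fintype α] (T : α → ℝ) {c : ℝ} (hc : 0 ≤ c) :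
    ({x | c < |T x|}.ncard : ℝ) * c ^ 2 ≤ ∑ x, T x ^ 2 := by
  classical
  rw [Set.ncard_eq_toFinset_card', ← nsmul_eq_mul, ← Finset.sum_const]
  refine (Finset.sum_le_sum fun x hx => ?_).trans
    (Finset.sum_le_univ_sum_of_nonneg fun x => sq_nonneg (T x))
  rw [Set.mem_toFinset] at hx
  rw [← sq_abs (T x)]
  exact pow_le_pow_left₀ hc (le_of_lt hx) 2

theorem isEstimableOn_of_local_approximation {Δ : ℕ} {C : Set FinGraph.{u}}
    (hC : ∀ G ∈ C, G.MaxDegLE Δ) {f : FinGraph.{u} → ℝ}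
    (hf : ∀ ε : ℝ, 0 < ε → ∃ r : ℕ, 0 < r ∧ ∃ ψ : Neighbourhood.{u} r → ℝ, ∀ G ∈ C,
      |f G - (∑ v, ψ (G.neighbourhood r v)) / G.order| ≤ ε) : IsEstimableOn C f := by
  constructor
  · obtain ⟨r, -, ψ, h⟩ := hf 1 one_pos
    obtain ⟨M, -, hM⟩ := exists_bound_of_bounded_degree Δ r ψ
    refine ⟨M + 1, fun G hG => ?_⟩
    have h1 := abs_le.1 (h G hG)
    have h2 := abs_le.1 (FinGraph.abs_average_le (hM G (hC G hG)))
    rw [abs_le]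
    constructor <;> linarith [h1.1, h1.2, h2.1, h2.2]
  · intro ε hε
    obtain ⟨r, hr, ψ, h⟩ := hf (ε / 2) (half_pos hε)
    obtain ⟨M, hM0, hM⟩ := exists_bound_of_bounded_degree Δ r ψ
    -- The centred values are at most 2M in absolute value and the sample mean may deviate by ε/2,
    -- so Chebyshev's bound is k(2M)² / (kε/2)² = 16M² / (kε²), which is to be at most ε.
    obtain ⟨k, hk⟩ := exists_nat_gt (16 * M ^ 2 / ε ^ 3)
    have hk0 : (0 : ℝ) < k := lt_of_le_of_lt (by positivity) hk
    refine ⟨k, r, Nat.cast_pos.1 hk0, hr, fun q => (∑ i, ψ (q i)) / k, fun G hG => ?_⟩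
    set μ := (∑ v, ψ (G.neighbourhood r v)) / G.order with hμ
    have hn : (0 : ℝ) < G.order := Nat.cast_pos.2 G.order_pos
    have hcard : (G.order : ℝ) = Fintype.card G.V := by
      rw [FinGraph.order, Nat.card_eq_fintype_card]
    have hμM : |μ| ≤ M := FinGraph.abs_average_le (hM G (hC G hG))
    set Y : G.V → ℝ := fun v => ψ (G.neighbourhood r v) - μ with hYdef
    have hY0 : ∑ v, Y v = 0 := by
      simp only [hYdef]
      rw [Finset.sum_sub_distrib, Finset.sum_const, Finset.card_univ, nsmul_eq_mul, ← hcard, hμ,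
        mul_div_cancel₀ _ hn.ne', sub_self]
    have hYM : ∀ v, |Y v| ≤ 2 * M := fun v =>
      (abs_sub _ _).trans (by linarith [hM G (hC G hG) v])
    have h1 := sum_sq_sum_sample Y hY0 hYM k
    have h2 := ncard_lt_abs_mul_sq_le (fun x : Fin k → G.V => ∑ i, Y (x i))
      (c := k * (ε / 2)) (by positivity)
    have hsub : {x : Fin k → G.V | ε < |f G - (∑ i, ψ (G.neighbourhood r (x i))) / k|} ⊆
        {x | k * (ε / 2) < |∑ i, Y (x i)|} := by
      intro x hx
      have hx' : ε < |f G - (∑ i, ψ (G.neighbourhood r (x i))) / k| := hx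
      have h3 : f G - (∑ i, ψ (G.neighbourhood r (x i))) / k =
          (f G - μ) - (∑ i, Y (x i)) / k := by
        simp only [hYdef]
        rw [Finset.sum_sub_distrib, Finset.sum_const, Finset.card_univ, Fintype.card_fin,
          nsmul_eq_mul]
        field_simp
        ring
      rw [h3] at hx'
      have h4 := (abs_sub (f G - μ) ((∑ i, Y (x i)) / k))
      have h5 := h G hG
      rw [abs_div, abs_of_pos hk0] at h4
      have h6 : ε / 2 < |∑ i, Y (x i)| / k := by linarith
      rw [lt_div_iff₀ hk0] at h6
      change k * (ε / 2) < |∑ i, Y (x i)|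
      linarith
    have h3 : ({x : Fin k → G.V | ε < |f G - (∑ i, ψ (G.neighbourhood r (x i))) / k|}.ncard : ℝ) ≤
        ({x : Fin k → G.V | k * (ε / 2) < |∑ i, Y (x i)|}.ncard : ℝ) :=
      Nat.cast_le.2 (Set.ncard_le_ncard hsub (Set.toFinite _))
    have h4 : (Nat.card (Fin k → G.V) : ℝ) = (Fintype.card G.V : ℝ) ^ k := by
      rw [Nat.card_eq_fintype_card, Fintype.card_fun, Fintype.card_fin, Nat.cast_pow]
    have hnk : (0 : ℝ) < (Fintype.card G.V : ℝ) ^ k := by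
      rw [← hcard]; positivity
    rw [h4, div_le_iff₀ hnk]
    refine h3.trans ?_
    have h5 := h2.trans h1
    have h6 : 16 * M ^ 2 ≤ k * ε ^ 3 := by
      rw [div_lt_iff₀ (by positivity)] at hk
      exact hk.le
    have hpos : (0 : ℝ) < (k * (ε / 2)) ^ 2 := by positivity
    refine le_of_mul_le_mul_right (h5.trans ?_) hpos
    have h7 : (k : ℝ) * (2 * M) ^ 2 * (Fintype.card G.V : ℝ) ^ k =
        (16 * M ^ 2) * (k / 4 * (Fintype.card G.V : ℝ) ^ k) := by ring
    have h8 : ε * (Fintype.card G.V : ℝ) ^ k * (k * (ε / 2)) ^ 2 =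
        (k * ε ^ 3) * (k / 4 * (Fintype.card G.V : ℝ) ^ k) := by ring
    rw [h7, h8]
    exact mul_le_mul_of_nonneg_right h6 (by positivity)

theorem exists_tendsto_of_approximation {a : ℕ → ℝ}
    (h : ∀ ε : ℝ, 0 < ε → ∃ (b : ℕ → ℝ) (l : ℝ), (∀ n, |a n - b n| ≤ ε) ∧
      Tendsto b atTop (𝓝 l)) : ∃ l : ℝ, Tendsto a atTop (𝓝 l) := by
  refine cauchySeq_tendsto_of_complete (Metric.cauchySeq_iff'.2 fun ε hε => ?_)
  obtain ⟨b, l, hab, hb⟩ := h (ε / 4) (by positivity)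
  obtain ⟨N, hN⟩ := Metric.cauchySeq_iff'.1 hb.cauchySeq (ε / 4) (by positivity)
  refine ⟨N, fun n hn => ?_⟩
  have h1 := hN n hn
  rw [Real.dist_eq] at h1 ⊢
  have h2 := abs_le.1 (hab n)
  have h3 := abs_le.1 (hab N)
  have h4 := abs_lt.1 h1
  rw [abs_lt]
  constructor <;> linarith [h2.1, h2.2, h3.1, h3.2, h4.1, h4.2]

/-- Each approximating average is a fixed finite combination of ball probabilities and so converges;
a uniform limit of convergent sequences is Cauchy. -/
theorem exists_tendsto_of_local_approximation {Δ : ℕ} {f : FinGraph.{u} → ℝ} {C : Set FinGraph.{u}}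
    (hC : ∀ G ∈ C, G.MaxDegLE Δ)
    (hf : ∀ ε : ℝ, 0 < ε → ∃ r : ℕ, 0 < r ∧ ∃ ψ : Neighbourhood.{u} r → ℝ, ∀ G ∈ C,
      |f G - (∑ v, ψ (G.neighbourhood r v)) / G.order| ≤ ε)
    {G : ℕ → FinGraph.{u}} (hG : ∀ n, G n ∈ C) (hconv : BSConvergent G) :
    ∃ l : ℝ, Tendsto (fun n => f (G n)) atTop (𝓝 l) := by
  refine exists_tendsto_of_approximation fun ε hε => ?_
  obtain ⟨r, hr, ψ, h⟩ := hf ε hε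
  choose p hp using fun q : Neighbourhood.{u} r => hconv.2 q.out.1 r hr
  refine ⟨_, ∑ q ∈ (finite_boundedNeighbourhoods.{u} Δ r).toFinset, ψ q * p q,
    fun n => h (G n) (hG n), ?_⟩
  simp only [fun n => FinGraph.average_eq_sum_ballProb (hC _ (hG n)) ψ]
  exact tendsto_finsetSum _ fun q _ => (hp q).const_mul (ψ q)

end Sampling

end EulerOr

theorem theorem2 :
    -- every Eulerian graph has an Eulerian orientation, so that the logarithm makes sense
    (∀ G : EulerOr.FinGraph.{u}, G.IsEulerian → 0 < G.numEulerianOrientations) ∧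
    -- convergence along Benjamini–Schramm convergent sequences of Eulerian graphs
    (∀ G : ℕ → EulerOr.FinGraph.{u}, EulerOr.BSConvergent G → (∀ n, (G n).IsEulerian) →
      ∃ l : ℝ, Tendsto
        (fun n => 1 / ((G n).order : ℝ) * Real.log ((G n).numEulerianOrientations : ℝ))
        atTop (𝓝 l)) ∧
    -- estimability on Eulerian graphs of bounded degree
    (∀ Δ : ℕ, EulerOr.IsEstimableOn
      {G : EulerOr.FinGraph.{u} | G.IsEulerian ∧ G.MaxDegLE Δ} EulerOr.FinGraph.entropy) := by
  have key : ∀ (Δ : ℕ) (ε : ℝ), 0 < ε → ∃ r : ℕ, 0 < r ∧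
      ∃ ψ : EulerOr.Neighbourhood.{u} r → ℝ,
        ∀ G ∈ {G : EulerOr.FinGraph.{u} | G.IsEulerian ∧ G.MaxDegLE Δ},
          |G.entropy - (∑ v, ψ (G.neighbourhood r v)) / G.order| ≤ ε := by
    intro Δ ε hε
    obtain ⟨r, hr, ψ, h⟩ := EulerOr.exists_local_approximation.{u} Δ hε
    exact ⟨r, hr, ψ, fun G hG => h G hG.1 hG.2⟩
  refine ⟨fun G hG => G.numEulerianOrientations_pos hG, fun G hconv hG => ?_, fun Δ => ?_⟩
  · obtain ⟨Δ, hΔ⟩ := hconv.1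
    exact EulerOr.exists_tendsto_of_local_approximation (Δ := Δ) (fun G hG => hG.2) (key Δ)
      (fun n => ⟨hG n, hΔ n⟩) hconv
  · exact EulerOr.isEstimableOn_of_local_approximation (Δ := Δ) (fun G hG => hG.2) (key Δ)
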